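/- For $n\in\mathbb N$ and $r>0$ let $\mathcal T(n,r)$ be the random geometric graph whose $n$ vertices are independent uniform random points of the square $[0,\sqrt n]^2$, two distinct vertices being adjacent when their distance $d_T$ in the torus $T_n=\mathbb R^2/(\sqrt n\,\mathbb Z)^2$ is at most $r$. The localization game on a graph $G$ is played in rounds. In each round the cops first choose a set of vertices (sensors). The robber, who sees the sensors, then moves to a neighbour of her current vertex or stays put (in the first round she chooses any vertex). Finally the cops learn the graph distances from all sensors of this round to the robber. The robber is detected in a round if the information that the cops have gathered up to and including that round determines her current vertex, that is, if only one vertex is the endpoint of a sequence of legal moves consistent with all the observed distances. **Theorem.** Let $r=r(n)$ satisfy $\log n\le r(n)<\sqrt n/4$ for all sufficiently large $n$, let $G\in\mathcal T(n,r)$, and let $\mathcal B_R$ be the closed ball of radius $r/3$ about the centre of the square $[0,\sqrt n]^2$. Then, with probability tending to $1$ as $n\to\infty$, the robber has a strategy in the localization game on $G$ with which she occupies a vertex in $\mathcal B_R$ in every round and is never detected, against all choices of the cops in which every round uses fewer than $$10^{-4}\,\frac{r^{4/3}}{(\log n)^{1/3}}$$ sensors. -/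

import Mathlib

open MeasureTheory ProbabilityTheory Filter Topology

noncomputable section

namespace LocalizationGame

/-! ### The localization game on a graph -/

section Game

variable {V : Type*}

/-- Two vertices have the same `S`-signature: they are at the same graph distance from every
sensor of `S` (the distance between vertices of different components is `⊤`). -/
def SameSignature (G : SimpleGraph V) (S : Finset V) (u v : V) : Prop :=
  ∀ s ∈ S, G.edist s u = G.edist s v

/-- The closed neighbourhood `N[A]` of a set of vertices. -/
def closedNbhd (G : SimpleGraph V) (A : Set V) : Set V :=
  {u | ∃ a ∈ A, u = a ∨ G.Adj a u}

/-- `candidates G S w i` is the set of vertices at which the robber can be after round `i`, given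
what the cops know: the graph, the rules, and the distances observed in rounds `0, …, i` when the
sensors are placed on `S 0, S 1, …` and the robber visits `w 0, w 1, …`. -/
def candidates (G : SimpleGraph V) (S : ℕ → Finset V) (w : ℕ → V) : ℕ → Set V
  | 0 => {u | SameSignature G (S 0) u (w 0)}
  | i + 1 => {u | u ∈ closedNbhd G (candidates G S w i) ∧
      SameSignature G (S (i + 1)) u (w (i + 1))}

/-- The position of the robber in round `i` if she follows the strategy `σ`, which maps the list
of sensor sets placed so far (those of the current round included) to a vertex. -/
def position (σ : List (Finset V) → V) (S : ℕ → Finset V) (i : ℕ) : V :=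
  σ ((List.range (i + 1)).map S)

/-- The robber has a strategy with which she stays in the vertex set `A` and is never located,
however the cops place fewer than `K` sensors in each round. -/
def RobberEvadesIn (G : SimpleGraph V) (K : ℝ) (A : Set V) : Prop :=
  ∃ σ : List (Finset V) → V, ∀ S : ℕ → Finset V, (∀ i, ((S i).card : ℝ) < K) →
    (∀ i, position σ S (i + 1) = position σ S i ∨
      G.Adj (position σ S i) (position σ S (i + 1))) ∧
    (∀ i, position σ S i ∈ A) ∧
    (∀ i, (candidates G S (position σ S) i).Nontrivial)

end Game

/-! ### The random geometric graph on the torus -/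

/-- The distance on the torus `ℝ² / (L ℤ)²` induced by the Euclidean distance. The norm on
`AddCircle L` is the distance to the nearest multiple of `L`. -/
def torusDist (L : ℝ) (x y : ℝ × ℝ) : ℝ :=
  Real.sqrt (‖((x.1 - y.1 : ℝ) : AddCircle L)‖ ^ 2 + ‖((x.2 - y.2 : ℝ) : AddCircle L)‖ ^ 2)

/-- The geometric graph on the torus with vertex positions `x` and threshold distance `r`. -/
def torusGraph (L r : ℝ) {n : ℕ} (x : Fin n → ℝ × ℝ) : SimpleGraph (Fin n) where
  Adj i j := i ≠ j ∧ torusDist L (x i) (x j) ≤ r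
  symm := ⟨fun i j h => ⟨h.1.symm, by
    have e : torusDist L (x j) (x i) = torusDist L (x i) (x j) := by
      unfold torusDist
      rw [← norm_neg ((((x j).1 - (x i).1 : ℝ)) : AddCircle L),
        ← norm_neg ((((x j).2 - (x i).2 : ℝ)) : AddCircle L),
        ← AddCircle.coe_neg, ← AddCircle.coe_neg, neg_sub, neg_sub]
    rw [e]; exact h.2⟩⟩
  loopless := ⟨fun _ h => h.1 rfl⟩

/-- The square `[0, √n]²`. -/
def square (n : ℕ) : Set (ℝ × ℝ) :=
  Set.Icc 0 (Real.sqrt n) ×ˢ Set.Icc 0 (Real.sqrt n)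

/-- The law of `n` independent points, each uniform in `[0, √n]²`. -/
def pointsLaw (n : ℕ) : Measure (Fin n → ℝ × ℝ) :=
  Measure.pi fun _ => (volume : Measure (ℝ × ℝ))[|square n]

/-- The vertices whose position is in the closed ball of radius `ρ` at the centre of the square. -/
def centralBall (ρ : ℝ) {n : ℕ} (x : Fin n → ℝ × ℝ) : Set (Fin n) :=
  {i | torusDist (Real.sqrt n) (x i) (Real.sqrt n / 2, Real.sqrt n / 2) ≤ ρ}

end LocalizationGame

end

noncomputable section

namespace LocalizationGame

/-! ### A clique with a pair of equal signatures for every sensor set -/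

section Clique

variable {V : Type*}

/-! The vertices in the core, a square of side `2r/5`, form a clique inside the ball of radius
`r/3`. If every admissible sensor set leaves two core vertices with equal signatures, the robber
moves each round to one vertex of such a pair. The clique makes every such move legal and keeps the
twin vertex a candidate (`RobberEvadesIn.of_clique`). It remains to show that with high probability
no `m` sensors separate the core.

From a sensor outside the core, the distances to the core take at most two values. Which one occurs
is decided by membership in a union of discs of radius `r` whose centres are positions outside the
core (`exists_level`, `exists_region_iff_imp_sameSignature`). Once the outer positions are fixed, a
sensor and a level `κ` determine the region, so `m` sensors give at most `(n²)^m` families of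
regions.

Cut the core into `N × N` cells. A union of discs cuts at most `12 N` of them (`ncard_cuts_le`), so
for `24 m ≤ N` at least half of the cells are cut by none of the `m` regions. Two non-sensor core
points in one uncut cell have equal signatures. Given the outer points, the core points are
independent and uniform (`measure_le_of_resample_le`), and `M` of them avoid all such collisions
with probability at most `exp(-M(M-1)/(16N²))` (`measure_noCollision_le`).

With `M` of order `r²` and `N` of order `m`, this beats the union bound `n^(2m)` when `m³ log n` is
at most a small multiple of `r⁴`, which gives the exponents `4/3` and `1/3`. -/

theorem position_comp_getLast (f : Finset V → V) (S : ℕ → Finset V) (i : ℕ) :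
    position (fun l => f (l.getLast?.getD ∅)) S i = f (S i) := by
  simp [position, List.range_succ]

theorem RobberEvadesIn.of_clique [Nonempty V] {G : SimpleGraph V} {K : ℝ} {A B : Set V}
    (hBA : B ⊆ A) (hB : ∀ u ∈ B, ∀ v ∈ B, u ≠ v → G.Adj u v)
    (h : ∀ S : Finset V, (S.card : ℝ) < K →
      ∃ u ∈ B, ∃ v ∈ B, u ≠ v ∧ SameSignature G S u v) :
    RobberEvadesIn G K A := by
  have hf : ∀ S : Finset V, ∃ u : V, (S.card : ℝ) < K →
      u ∈ B ∧ ∃ v ∈ B, v ≠ u ∧ SameSignature G S v u := by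
    intro S
    by_cases hS : (S.card : ℝ) < K
    · obtain ⟨u, hu, v, hv, huv, hs⟩ := h S hS
      exact ⟨v, fun _ => ⟨hv, u, hu, huv, hs⟩⟩
    -- Sets this large are never played, so the value is irrelevant.
    · exact ⟨Classical.arbitrary V, fun h => absurd h hS⟩
  choose f hf using hf
  refine ⟨fun l => f (l.getLast?.getD ∅), fun S hS => ?_⟩
  have hpos : position (fun l => f (l.getLast?.getD ∅)) S = fun i => f (S i) :=
    funext (position_comp_getLast f S)
  rw [hpos]
  have hmem : ∀ i, f (S i) ∈ B := fun i => (hf (S i) (hS i)).1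
  -- The true position is always a candidate and is adjacent to all other vertices of `B`, so
  -- nothing learnt earlier excludes a vertex of `B`.
  have hcand : ∀ i, ∀ u ∈ B, SameSignature G (S i) u (f (S i)) →
      u ∈ candidates G S (fun i => f (S i)) i := by
    intro i
    induction i with
    | zero => exact fun u _ hs => hs
    | succ i ih =>
      intro u hu hs
      refine ⟨⟨f (S i), ih _ (hmem i) (fun _ _ => rfl), ?_⟩, hs⟩
      by_cases e : u = f (S i)
      · exact Or.inl e
      · exact Or.inr (hB _ (hmem i) _ hu (Ne.symm e))
  refine ⟨fun i => ?_, fun i => hBA (hmem i), fun i => ?_⟩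
  · by_cases e : f (S (i + 1)) = f (S i)
    · exact Or.inl e
    · exact Or.inr (hB _ (hmem i) _ (hmem (i + 1)) (Ne.symm e))
  · obtain ⟨hu, v, hv, hvu, hs⟩ := hf (S i) (hS i)
    exact ⟨v, hcand i v hv hs, f (S i), hcand i _ hu (fun _ _ => rfl), hvu⟩

/-! ### Distances from a sensor to a clique -/

/-- The graph `G` with all edges meeting `I` removed. -/
def outerGraph (G : SimpleGraph V) (I : Set V) : SimpleGraph V where
  Adj u v := G.Adj u v ∧ u ∉ I ∧ v ∉ I
  symm := ⟨fun _ _ h => ⟨h.1.symm, h.2.2, h.2.1⟩⟩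
  loopless := ⟨fun _ h => h.1.ne rfl⟩

theorem outerGraph_le (G : SimpleGraph V) (I : Set V) : outerGraph G I ≤ G :=
  fun _ _ h => h.1

/-- A walk from `s` of length at most `κ` is too short to meet `I`, so all its edges survive in the
outer graph. -/
theorem outerGraph_edist_le {G : SimpleGraph V} {I : Set V} {s : V} {κ : ℕ}
    (hκ : ∀ i ∈ I, (κ : ℕ∞) < G.edist s i) (j : ℕ) (hj : j ≤ κ) (v : V) (p : G.Walk s v)
    (hp : p.length = j) : v ∉ I ∧ (outerGraph G I).edist s v ≤ j := by
  induction j generalizing v with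
  | zero =>
    have := SimpleGraph.Walk.eq_of_length_eq_zero hp
    subst this
    refine ⟨fun h => ?_, by simp⟩
    have := hκ s h
    simp at this
  | succ j ih =>
    have hv : v ∉ I := by
      intro h
      have h1 := hκ v h
      have h2 : G.edist s v ≤ ((j + 1 : ℕ) : ℕ∞) := hp ▸ SimpleGraph.edist_le p
      have h3 : ((j + 1 : ℕ) : ℕ∞) ≤ κ := by exact_mod_cast hj
      exact absurd (h2.trans h3) (not_le.2 h1)
    refine ⟨hv, ?_⟩
    have hnil : ¬ p.Nil := by
      intro h
      have := SimpleGraph.Walk.length_eq_zero_iff.2 h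
      omega
    have hd : p.dropLast.length = j := by
      have := SimpleGraph.Walk.length_dropLast_add_one hnil
      omega
    obtain ⟨hu, hd'⟩ := ih (by omega) _ p.dropLast hd
    have hadj : (outerGraph G I).Adj p.penultimate v :=
      ⟨SimpleGraph.Walk.adj_penultimate hnil, hu, hv⟩
    calc (outerGraph G I).edist s v
        ≤ (outerGraph G I).edist s p.penultimate + (outerGraph G I).edist p.penultimate v :=
          SimpleGraph.edist_triangle
      _ ≤ j + 1 := add_le_add hd' (SimpleGraph.edist_eq_one_iff_adj.2 hadj).le
      _ = ((j + 1 : ℕ) : ℕ∞) := by push_cast; rfl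

/-- Inside a clique `I`, the distance from an outer vertex `s` only depends on being adjacent to
one of the outer vertices within a suitable distance `κ` of `s` in the graph outside `I`. -/
theorem exists_level [Fintype V] [Nonempty V] (G : SimpleGraph V) (I : Set V)
    (hI : ∀ u ∈ I, ∀ v ∈ I, u ≠ v → G.Adj u v) (s : V) (hs : s ∉ I) :
    ∃ κ : Fin (Fintype.card V), ∀ i ∈ I, ∀ j ∈ I,
      ((∃ w, w ∉ I ∧ (outerGraph G I).edist s w ≤ ((κ : ℕ) : ℕ∞) ∧ G.Adj w i) ↔
        (∃ w, w ∉ I ∧ (outerGraph G I).edist s w ≤ ((κ : ℕ) : ℕ∞) ∧ G.Adj w j)) →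
      G.edist s i = G.edist s j := by
  classical
  by_cases hfin : ∃ k : ℕ, ∃ i ∈ I, G.edist s i = k
  · obtain ⟨i₀, hi₀, hk₀⟩ := Nat.find_spec hfin
    have hmin : ∀ i ∈ I, ((Nat.find hfin : ℕ) : ℕ∞) ≤ G.edist s i := by
      intro i hi
      by_contra hlt
      push Not at hlt
      obtain ⟨k, hk⟩ := ENat.ne_top_iff_exists.1 (ne_top_of_lt hlt)
      rw [← hk] at hlt
      exact Nat.find_min hfin (by exact_mod_cast hlt) ⟨i, hi, hk.symm⟩
    generalize Nat.find hfin = k at hk₀ hmin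
    have hkpos : k ≠ 0 := by
      rintro rfl
      have : s = i₀ := (SimpleGraph.edist_eq_zero_iff (G := G)).1 (by simpa using hk₀)
      exact hs (this ▸ hi₀)
    obtain ⟨κ, rfl⟩ := Nat.exists_eq_succ_of_ne_zero hkpos
    have hκ : ∀ i ∈ I, (κ : ℕ∞) < G.edist s i := fun i hi =>
      lt_of_lt_of_le (by exact_mod_cast Nat.lt_succ_self κ) (hmin i hi)
    -- A shortest path is a path, so it has fewer edges than there are vertices. This leaves only
    -- finitely many levels for the later union bound.
    have hcard : κ < Fintype.card V := by
      have hr : G.Reachable s i₀ := SimpleGraph.reachable_of_edist_ne_top (by rw [hk₀]; simp)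
      obtain ⟨p, hp, hpl⟩ := hr.exists_path_of_dist
      have h1 := hp.length_lt
      have h2 := hr.coe_dist_eq_edist
      rw [hk₀] at h2
      have h3 : G.dist s i₀ = κ + 1 := by exact_mod_cast h2
      omega
    have hchar : ∀ i ∈ I, (∃ w, w ∉ I ∧ (outerGraph G I).edist s w ≤ (κ : ℕ∞) ∧ G.Adj w i) ↔
        G.edist s i = ((κ + 1 : ℕ) : ℕ∞) := by
      intro i hi
      constructor
      · rintro ⟨w, -, hw, ha⟩
        refine le_antisymm ?_ (hmin i hi)
        calc G.edist s i ≤ G.edist s w + G.edist w i := SimpleGraph.edist_triangle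
          _ ≤ κ + 1 := add_le_add ((SimpleGraph.edist_anti (outerGraph_le G I)).trans hw)
              (SimpleGraph.edist_eq_one_iff_adj.2 ha).le
          _ = ((κ + 1 : ℕ) : ℕ∞) := by push_cast; rfl
      · intro h
        obtain ⟨p, hp⟩ := SimpleGraph.exists_walk_of_edist_eq_coe h
        have hnil : ¬ p.Nil := by
          intro h
          have := SimpleGraph.Walk.length_eq_zero_iff.2 h
          omega
        have hd : p.dropLast.length = κ := by
          have := SimpleGraph.Walk.length_dropLast_add_one hnil
          omega
        obtain ⟨h1, h2⟩ := outerGraph_edist_le hκ κ le_rfl _ p.dropLast hd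
        exact ⟨_, h1, h2, SimpleGraph.Walk.adj_penultimate hnil⟩
    -- One more step inside the clique reaches every vertex of `I`, so only the values `κ + 1` and
    -- `κ + 2` occur.
    have hle : ∀ i ∈ I, G.edist s i ≤ ((κ + 1 : ℕ) : ℕ∞) + 1 := by
      intro i hi
      by_cases e : i₀ = i
      · rw [← e, hk₀]; exact le_self_add
      · calc G.edist s i ≤ G.edist s i₀ + G.edist i₀ i := SimpleGraph.edist_triangle
          _ ≤ _ := add_le_add hk₀.le (SimpleGraph.edist_eq_one_iff_adj.2 (hI _ hi₀ _ hi e)).le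
    refine ⟨⟨κ, hcard⟩, fun i hi j hj hij => ?_⟩
    have hij' : G.edist s i = ((κ + 1 : ℕ) : ℕ∞) ↔ G.edist s j = ((κ + 1 : ℕ) : ℕ∞) := by
      rw [← hchar i hi, ← hchar j hj]; exact hij
    have htop : ∀ i ∈ I, G.edist s i ≠ ((κ + 1 : ℕ) : ℕ∞) →
        G.edist s i = ((κ + 1 : ℕ) : ℕ∞) + 1 := by
      intro i hi hne
      refine le_antisymm (hle i hi) ?_
      exact Order.add_one_le_of_lt (lt_of_le_of_ne (hmin i hi) (Ne.symm hne))
    by_cases h : G.edist s i = ((κ + 1 : ℕ) : ℕ∞)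
    · rw [h, hij'.1 h]
    · rw [htop i hi h, htop j hj (fun h' => h (hij'.2 h'))]
  · have htop : ∀ i ∈ I, G.edist s i = ⊤ := by
      intro i hi
      by_contra hne
      obtain ⟨k, hk⟩ := ENat.ne_top_iff_exists.1 hne
      exact hfin ⟨k, i, hi, hk.symm⟩
    -- No vertex of `I` is reachable from `s`, so any level serves.
    exact ⟨⟨0, Fintype.card_pos⟩, fun i hi j hj _ => by rw [htop i hi, htop j hj]⟩

end Clique

/-! ### Unions of discs and a grid of small squares -/

section Geometry

/-- The half-open square with side `2 r / 5` at the centre of `[0, L]²`. -/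
def core (L r : ℝ) : Set (ℝ × ℝ) :=
  Set.Ico (L / 2 - r / 5) (L / 2 + r / 5) ×ˢ Set.Ico (L / 2 - r / 5) (L / 2 + r / 5)

/-- The `a`-th of the `N` half-open intervals of equal length that make up a side of `core L r`. -/
def side (L r : ℝ) (N : ℕ) (a : Fin N) : Set ℝ :=
  Set.Ico (L / 2 - r / 5 + a * (2 * r / 5 / N)) (L / 2 - r / 5 + (a + 1) * (2 * r / 5 / N))

/-- The cells of the `N × N` grid that partitions `core L r`. -/
def cell (L r : ℝ) (N : ℕ) (c : Fin N × Fin N) : Set (ℝ × ℝ) :=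
  side L r N c.1 ×ˢ side L r N c.2

/-- The union of the closed discs of radius `r` on the torus with centres in `C`. -/
def discUnion (L r : ℝ) (C : Set (ℝ × ℝ)) : Set (ℝ × ℝ) :=
  {p | ∃ w ∈ C, torusDist L w p ≤ r}

/-- The set `U` contains a part of `Q`, but not all of it. -/
def Cuts (U Q : Set (ℝ × ℝ)) : Prop :=
  (∃ p ∈ Q, p ∈ U) ∧ ∃ q ∈ Q, q ∉ U

/-- Take the representative of `x` in `[0, L)`. Near `L/2` its difference from `t` wraps around only
when both the circle distance and the real distance exceed `r`, which suffices for comparing with a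
disc of radius `r`. -/
theorem exists_norm_sub_eq {L r : ℝ} (hr : 0 < r) (hL : 4 * r < L) (x : ℝ) :
    ∃ x' : ℝ, ∀ t, |t - L / 2| ≤ r / 5 →
      ‖((x - t : ℝ) : AddCircle L)‖ = |x' - t| ∨
        (r < ‖((x - t : ℝ) : AddCircle L)‖ ∧ r < |x' - t|) := by
  have hL0 : 0 < L := by linarith
  refine ⟨toIcoMod hL0 0 x, fun t ht => ?_⟩
  have hmem := toIcoMod_mem_Ico hL0 0 x
  set x' := toIcoMod hL0 0 x with hx'
  have hcoe : ((x - t : ℝ) : AddCircle L) = ((x' - t : ℝ) : AddCircle L) := by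
    rw [hx', toIcoMod, AddCircle.coe_sub, AddCircle.coe_sub, AddCircle.coe_sub,
      AddCircle.coe_zsmul, AddCircle.coe_period]
    simp
  rw [hcoe]
  have h0 : 0 ≤ x' := hmem.1
  have h1 : x' < L := by simpa using hmem.2
  obtain ⟨ht1, ht2⟩ := abs_le.1 ht
  by_cases hle : |x' - t| ≤ L / 2
  · exact Or.inl ((AddCircle.norm_coe_eq_abs_iff L hL0.ne').2 (by rwa [abs_of_pos hL0]))
  · right
    push Not at hle
    refine ⟨?_, by linarith⟩
    rcases le_total 0 (x' - t) with hs | hs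
    · rw [abs_of_nonneg hs] at hle
      have e : ((x' - t : ℝ) : AddCircle L) = ((x' - t - L : ℝ) : AddCircle L) := by
        rw [AddCircle.coe_sub (x := x' - t) (y := L), AddCircle.coe_period, sub_zero]
      have hneg : x' - t - L ≤ 0 := by linarith
      rw [e, (AddCircle.norm_coe_eq_abs_iff L hL0.ne').2
        (by rw [abs_of_pos hL0, abs_of_nonpos hneg]; linarith), abs_of_nonpos hneg]
      linarith
    · rw [abs_of_nonpos hs] at hle
      have e : ((x' - t : ℝ) : AddCircle L) = ((x' - t + L : ℝ) : AddCircle L) := by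
        rw [AddCircle.coe_add (x := x' - t) (y := L), AddCircle.coe_period, add_zero]
      have hpos : 0 ≤ x' - t + L := by linarith
      rw [e, (AddCircle.norm_coe_eq_abs_iff L hL0.ne').2
        (by rw [abs_of_pos hL0, abs_of_nonneg hpos]; linarith), abs_of_nonneg hpos]
      linarith

theorem abs_sub_half_le {L r t : ℝ} (ht : t ∈ Set.Ico (L / 2 - r / 5) (L / 2 + r / 5)) :
    |t - L / 2| ≤ r / 5 :=
  abs_le.2 ⟨by linarith [ht.1], by linarith [ht.2]⟩

/-- Seen from the core, a disc on the torus is a disc in the plane. -/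
theorem exists_torusDist_le_iff {L r : ℝ} (hr : 0 < r) (hL : 4 * r < L) (w : ℝ × ℝ) :
    ∃ w' : ℝ × ℝ, ∀ p ∈ core L r,
      (torusDist L w p ≤ r ↔ (w'.1 - p.1) ^ 2 + (w'.2 - p.2) ^ 2 ≤ r ^ 2) := by
  obtain ⟨x, hx⟩ := exists_norm_sub_eq hr hL w.1
  obtain ⟨y, hy⟩ := exists_norm_sub_eq hr hL w.2
  refine ⟨(x, y), fun p hp => ?_⟩
  rw [torusDist, Real.sqrt_le_left hr.le]
  have hx := hx p.1 (abs_sub_half_le hp.1)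
  have hy := hy p.2 (abs_sub_half_le hp.2)
  rw [← sq_abs (x - p.1), ← sq_abs (y - p.2)]
  have hbig : ∀ a b : ℝ, r < a → ¬ (a ^ 2 + b ^ 2 ≤ r ^ 2) := fun a b ha h => by
    nlinarith [sq_nonneg b]
  have hbig' : ∀ a b : ℝ, r < b → ¬ (a ^ 2 + b ^ 2 ≤ r ^ 2) := fun a b ha h => by
    nlinarith [sq_nonneg a]
  rcases hx with hx | ⟨hx, hfar⟩
  · rcases hy with hy | ⟨hy, hy'⟩
    · rw [hx, hy]
    · exact iff_of_false (hbig' _ _ hy) (hbig' _ _ hy')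
  · exact iff_of_false (hbig _ _ hx) (hbig _ _ hfar)

/-- A point of a column that lies sufficiently far in the direction of the centre of a disc from
a square met by the boundary of the disc lies in the disc. -/
theorem sq_add_sq_le_of_far {v₁ v₂ d₁ d₂ x y ε r : ℝ} (hε : 0 < ε) (hεr : ε ≤ r / 100)
    (hv : v₁ ^ 2 + v₂ ^ 2 ≤ r ^ 2) (hdir : |v₁| ≤ v₂)
    (hd : r ^ 2 < (v₁ - d₁) ^ 2 + (v₂ - d₂) ^ 2) (hd₁ : |d₁| ≤ ε) (hd₂ : |d₂| ≤ ε)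
    (hx : |x| ≤ ε) (hy : 2 * ε ≤ y) (hy' : y ≤ 2 * r / 5) :
    (v₁ - x) ^ 2 + (v₂ - y) ^ 2 ≤ r ^ 2 := by
  have hv0 : 0 ≤ v₂ := (abs_nonneg _).trans hdir
  have h1 : (v₁ - d₁) ^ 2 ≤ (v₂ + ε) ^ 2 := by
    refine sq_le_sq' ?_ ?_ <;> linarith [abs_le.1 hdir, abs_le.1 hd₁]
  have h2 : (v₂ - d₂) ^ 2 ≤ (v₂ + ε) ^ 2 := by
    refine sq_le_sq' ?_ ?_ <;> linarith [abs_le.1 hdir, abs_le.1 hd₂]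
  have hr : 0 < r := by linarith
  have h3 : (7 / 10) * r < v₂ + ε := by
    by_contra h
    push Not at h
    nlinarith
  have h4 : (69 / 100) * r ≤ v₂ := by linarith
  have h5 : -(v₁ * x) ≤ v₂ * ε := by
    calc -(v₁ * x) ≤ |v₁ * x| := neg_le_abs _
      _ = |v₁| * |x| := abs_mul _ _
      _ ≤ v₂ * ε := mul_le_mul hdir hx (abs_nonneg _) hv0
  have h6 : x ^ 2 ≤ ε ^ 2 := sq_le_sq' (by linarith [abs_le.1 hx]) (by linarith [abs_le.1 hx])
  have hy0 : 0 < y := by linarith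
  have h7 : v₂ * (2 * ε) ≤ v₂ * y := mul_le_mul_of_nonneg_left hy hv0
  have h8 : (69 / 100) * r * y ≤ v₂ * y := mul_le_mul_of_nonneg_right h4 hy0.le
  have h9 : y * y ≤ 2 * r / 5 * y := mul_le_mul_of_nonneg_right hy' hy0.le
  have h10 : ε * ε ≤ r / 100 * y := mul_le_mul hεr (by linarith) hε.le (by linarith)
  -- The squared length changes by at most `-v₂ y + y² + ε²`, which is at most `(-0.69 + 0.4 + 0.01)
  -- r y`.
  nlinarith [mul_pos hr hy0]

/-- Selected indices in one column differ by at most two, so their residues modulo 3 are distinct.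
-/
theorem card_le_of_column_bound {N : ℕ} (P : Fin N → Fin N → Prop)
    (hP : ∀ a b b', P a b → P a b' → (b' : ℕ) < b + 3) :
    {c : Fin N × Fin N | P c.1 c.2}.ncard ≤ 3 * N := by
  have hmod : ∀ k : ℕ, k % 3 < 3 := fun k => Nat.mod_lt _ (by norm_num)
  calc {c : Fin N × Fin N | P c.1 c.2}.ncard
      ≤ (Set.univ : Set (Fin N × Fin 3)).ncard := by
        refine Set.ncard_le_ncard_of_injOn (fun c => (c.1, ⟨(c.2 : ℕ) % 3, hmod _⟩))
          (fun _ _ => Set.mem_univ _) ?_ (Set.toFinite _)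
        rintro ⟨a, b⟩ h ⟨a', b'⟩ h' e
        simp only [Prod.mk.injEq, Fin.mk.injEq] at e
        obtain ⟨rfl, e⟩ := e
        have h1 := hP _ _ _ h h'
        have h2 := hP _ _ _ h' h
        simp only at h1 h2
        exact Prod.ext rfl (Fin.ext (by simp only; omega))
    _ = 3 * N := by
        rw [Set.ncard_univ, Nat.card_eq_fintype_card, Fintype.card_prod, Fintype.card_fin,
          Fintype.card_fin, mul_comm]

theorem side_subset {L r : ℝ} (hr : 0 < r) {N : ℕ} (a : Fin N) :
    side L r N a ⊆ Set.Ico (L / 2 - r / 5) (L / 2 + r / 5) := by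
  have hN : (0 : ℝ) < N := by exact_mod_cast a.pos
  have hε : 0 < 2 * r / 5 / N := by positivity
  have ha : ((a : ℕ) : ℝ) + 1 ≤ N := by exact_mod_cast a.isLt
  have h1 : (((a : ℕ) : ℝ) + 1) * (2 * r / 5 / N) ≤ N * (2 * r / 5 / N) :=
    mul_le_mul_of_nonneg_right ha hε.le
  have h2 : (N : ℝ) * (2 * r / 5 / N) = 2 * r / 5 := by field_simp
  have h3 : 0 ≤ ((a : ℕ) : ℝ) * (2 * r / 5 / N) := by positivity
  rintro t ⟨ht1, ht2⟩
  exact ⟨by linarith, by linarith⟩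

theorem cell_subset_core {L r : ℝ} (hr : 0 < r) {N : ℕ} (c : Fin N × Fin N) :
    cell L r N c ⊆ core L r :=
  Set.prod_mono (side_subset hr _) (side_subset hr _)

theorem abs_sub_le_of_mem_side {L r s t : ℝ} {N : ℕ} {a : Fin N} (hs : s ∈ side L r N a)
    (ht : t ∈ side L r N a) : |s - t| ≤ 2 * r / 5 / N := by
  have e : (((a : ℕ) : ℝ) + 1) * (2 * r / 5 / N) = a * (2 * r / 5 / N) + 2 * r / 5 / N := by ring
  have h1 := hs.2
  have h2 := ht.2
  rw [e] at h1 h2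
  exact abs_le.2 ⟨by linarith [hs.1], by linarith [ht.1]⟩

theorem sub_mem_of_mem_side {L r s t : ℝ} (hr : 0 < r) {N : ℕ} {b b' : Fin N}
    (hb : (b : ℕ) + 3 ≤ b') (hs : s ∈ side L r N b) (ht : t ∈ side L r N b') :
    2 * (2 * r / 5 / N) ≤ t - s ∧ t - s ≤ 2 * r / 5 := by
  have hN : (0 : ℝ) < N := by exact_mod_cast b.pos
  have hε : 0 < 2 * r / 5 / N := by positivity
  have hb' : ((b : ℕ) : ℝ) + 3 ≤ (b' : ℕ) := by exact_mod_cast hb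
  have h1 : (((b : ℕ) : ℝ) + 3) * (2 * r / 5 / N) ≤ (b' : ℕ) * (2 * r / 5 / N) :=
    mul_le_mul_of_nonneg_right hb' hε.le
  refine ⟨by linarith [hs.2, ht.1], ?_⟩
  linarith [(side_subset hr _ hs).1, (side_subset hr _ ht).2]

/-- A union of discs of radius `r` cuts few cells of the grid. -/
theorem ncard_cuts_le {L r : ℝ} (hr : 0 < r) (hL : 4 * r < L) {N : ℕ} (hN : 40 ≤ N)
    (C : Set (ℝ × ℝ)) :
    {c : Fin N × Fin N | Cuts (discUnion L r C) (cell L r N c)}.ncard ≤ 12 * N := by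
  choose f hf using exists_torusDist_le_iff hr hL
  have hN' : (40 : ℝ) ≤ N := by exact_mod_cast hN
  have hN0 : (0 : ℝ) < N := by linarith
  set ε := 2 * r / 5 / N with hεdef
  have hε : 0 < ε := by positivity
  have hεr : ε ≤ r / 100 := by
    rw [hεdef, div_le_iff₀ hN0]
    nlinarith
  let T : ℝ × ℝ → ℝ × ℝ → ℝ × ℝ → Prop := fun w p q => w ∈ C ∧
    ((f w).1 - p.1) ^ 2 + ((f w).2 - p.2) ^ 2 ≤ r ^ 2 ∧
    r ^ 2 < ((f w).1 - q.1) ^ 2 + ((f w).2 - q.2) ^ 2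
  -- Cut cells are sorted by the dominant axis direction from a covered point `p` to the centre of
  -- its disc. A cell of the same column (or row) at least three steps further in that direction
  -- lies entirely in the disc, hence is not cut.
  let Up : Fin N → Fin N → Prop := fun a b => ∃ w, ∃ p ∈ cell L r N (a, b),
    ∃ q ∈ cell L r N (a, b), T w p q ∧ q ∉ discUnion L r C ∧ |(f w).1 - p.1| ≤ (f w).2 - p.2
  let Down : Fin N → Fin N → Prop := fun a b => ∃ w, ∃ p ∈ cell L r N (a, b),
    ∃ q ∈ cell L r N (a, b), T w p q ∧ q ∉ discUnion L r C ∧ |(f w).1 - p.1| ≤ -((f w).2 - p.2)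
  let Right : Fin N → Fin N → Prop := fun b a => ∃ w, ∃ p ∈ cell L r N (a, b),
    ∃ q ∈ cell L r N (a, b), T w p q ∧ q ∉ discUnion L r C ∧ |(f w).2 - p.2| ≤ (f w).1 - p.1
  let Left : Fin N → Fin N → Prop := fun b a => ∃ w, ∃ p ∈ cell L r N (a, b),
    ∃ q ∈ cell L r N (a, b), T w p q ∧ q ∉ discUnion L r C ∧ |(f w).2 - p.2| ≤ -((f w).1 - p.1)
  have hUp : {c : Fin N × Fin N | Up c.1 c.2}.ncard ≤ 3 * N := by
    refine card_le_of_column_bound Up ?_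
    rintro a b b' ⟨w, p, hp, q, hq, ⟨hw, hwp, hwq⟩, -, hdir⟩ ⟨-, -, -, q', hq', -, hq'U, -⟩
    by_contra hlt
    push Not at hlt
    obtain ⟨h1, h2⟩ := sub_mem_of_mem_side hr hlt hp.2 hq'.2
    refine hq'U ⟨w, hw, (hf w q' (cell_subset_core hr _ hq')).2 ?_⟩
    have := sq_add_sq_le_of_far hε hεr hwp hdir
      (d₁ := q.1 - p.1) (d₂ := q.2 - p.2) (by convert hwq using 2 <;> ring)
      (abs_sub_le_of_mem_side hq.1 hp.1) (abs_sub_le_of_mem_side hq.2 hp.2)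
      (abs_sub_le_of_mem_side hq'.1 hp.1) h1 h2
    convert this using 2 <;> ring
  -- The mirror image of the previous case: the covering cell is now the one with the larger index.
  have hDown : {c : Fin N × Fin N | Down c.1 c.2}.ncard ≤ 3 * N := by
    refine card_le_of_column_bound Down ?_
    rintro a b' b ⟨-, -, -, q', hq', -, hq'U, -⟩ ⟨w, p, hp, q, hq, ⟨hw, hwp, hwq⟩, -, hdir⟩
    by_contra hlt
    push Not at hlt
    obtain ⟨h1, h2⟩ := sub_mem_of_mem_side hr hlt hq'.2 hp.2
    refine hq'U ⟨w, hw, (hf w q' (cell_subset_core hr _ hq')).2 ?_⟩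
    have := sq_add_sq_le_of_far hε hεr (by convert hwp using 2; ring) hdir
      (d₁ := q.1 - p.1) (d₂ := p.2 - q.2) (by convert hwq using 2 <;> ring)
      (abs_sub_le_of_mem_side hq.1 hp.1) (abs_sub_le_of_mem_side hp.2 hq.2)
      (abs_sub_le_of_mem_side hq'.1 hp.1) h1 h2
    convert this using 2 <;> ring
  have hRight : {c : Fin N × Fin N | Right c.1 c.2}.ncard ≤ 3 * N := by
    refine card_le_of_column_bound Right ?_
    rintro a b b' ⟨w, p, hp, q, hq, ⟨hw, hwp, hwq⟩, -, hdir⟩ ⟨-, -, -, q', hq', -, hq'U, -⟩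
    by_contra hlt
    push Not at hlt
    obtain ⟨h1, h2⟩ := sub_mem_of_mem_side hr hlt hp.1 hq'.1
    refine hq'U ⟨w, hw, (hf w q' (cell_subset_core hr _ hq')).2 ?_⟩
    have := sq_add_sq_le_of_far hε hεr (by rwa [add_comm]) hdir
      (d₁ := q.2 - p.2) (d₂ := q.1 - p.1) (by rw [add_comm]; convert hwq using 2 <;> ring)
      (abs_sub_le_of_mem_side hq.2 hp.2) (abs_sub_le_of_mem_side hq.1 hp.1)
      (abs_sub_le_of_mem_side hq'.2 hp.2) h1 h2
    rw [add_comm]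
    convert this using 2 <;> ring
  have hLeft : {c : Fin N × Fin N | Left c.1 c.2}.ncard ≤ 3 * N := by
    refine card_le_of_column_bound Left ?_
    rintro a b' b ⟨-, -, -, q', hq', -, hq'U, -⟩ ⟨w, p, hp, q, hq, ⟨hw, hwp, hwq⟩, -, hdir⟩
    by_contra hlt
    push Not at hlt
    obtain ⟨h1, h2⟩ := sub_mem_of_mem_side hr hlt hq'.1 hp.1
    refine hq'U ⟨w, hw, (hf w q' (cell_subset_core hr _ hq')).2 ?_⟩
    have := sq_add_sq_le_of_far hε hεr (by rw [add_comm]; convert hwp using 2; ring) hdir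
      (d₁ := q.2 - p.2) (d₂ := p.1 - q.1) (by rw [add_comm]; convert hwq using 2 <;> ring)
      (abs_sub_le_of_mem_side hq.2 hp.2) (abs_sub_le_of_mem_side hp.1 hq.1)
      (abs_sub_le_of_mem_side hq'.2 hp.2) h1 h2
    rw [add_comm]
    convert this using 2 <;> ring
  have hswap : ∀ P : Fin N → Fin N → Prop, {c : Fin N × Fin N | P c.2 c.1}.ncard =
      {c : Fin N × Fin N | P c.1 c.2}.ncard := fun P =>
    Set.ncard_congr (fun c _ => c.swap) (fun _ h => h) (fun _ _ _ _ h => Prod.swap_injective h)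
      (fun c h => ⟨c.swap, h, c.swap_swap⟩)
  have hsub : {c : Fin N × Fin N | Cuts (discUnion L r C) (cell L r N c)} ⊆
      ({c | Up c.1 c.2} ∪ {c | Down c.1 c.2}) ∪ ({c | Right c.2 c.1} ∪ {c | Left c.2 c.1}) := by
    rintro c ⟨⟨p, hp, w, hw, hpw⟩, q, hq, hqU⟩
    have hwp := (hf w p (cell_subset_core hr _ hp)).1 hpw
    have hwq : r ^ 2 < ((f w).1 - q.1) ^ 2 + ((f w).2 - q.2) ^ 2 := by
      by_contra h
      push Not at h
      exact hqU ⟨w, hw, (hf w q (cell_subset_core hr _ hq)).2 h⟩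
    have hT : T w p q := ⟨hw, hwp, hwq⟩
    rcases le_total |(f w).1 - p.1| |(f w).2 - p.2| with h | h
    · left
      rcases le_total 0 ((f w).2 - p.2) with h0 | h0
      · left
        rw [abs_of_nonneg h0] at h
        exact ⟨w, p, hp, q, hq, hT, hqU, h⟩
      · right
        rw [abs_of_nonpos h0] at h
        exact ⟨w, p, hp, q, hq, hT, hqU, h⟩
    · right
      rcases le_total 0 ((f w).1 - p.1) with h0 | h0
      · left
        rw [abs_of_nonneg h0] at h
        exact ⟨w, p, hp, q, hq, hT, hqU, h⟩
      · right
        rw [abs_of_nonpos h0] at h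
        exact ⟨w, p, hp, q, hq, hT, hqU, h⟩
  calc _ ≤ _ := Set.ncard_le_ncard hsub (Set.toFinite _)
    _ ≤ _ := Set.ncard_union_le _ _
    _ ≤ _ := add_le_add (Set.ncard_union_le _ _) (Set.ncard_union_le _ _)
    _ ≤ (3 * N + 3 * N) + (3 * N + 3 * N) := by
      rw [hswap Right, hswap Left]
      exact add_le_add (add_le_add hUp hDown) (add_le_add hRight hLeft)
    _ = 12 * N := by ring

end Geometry

/-! ### Collisions of independent points in cells of equal probability -/

section Collisions

/-- A bound for the probability that `j` further points do not collide when `a` cells are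
occupied and each cell has probability `q`. -/
def collisionBound (q : ℝ) (j a : ℕ) : ℝ :=
  Real.exp (-(q * ((j : ℝ) * a / 2 + (j : ℝ) * (j - 1) / 16)))

/-- Reveal one point: a cell outside the good ones keeps `a`, a free good cell raises it by one, and
an occupied cell is forbidden. The bounds `exp(-t) ≤ 1 - t/2` on `[0, 1]` and `1 - t ≤ exp(-t)`
close the recursion. Each step contributes `q j / 8`, and these sum to the term with denominator 16.
-/
theorem collisionBound_step {q g l : ℝ} {j a : ℕ} (hq : 0 < q) (hl : q * l = 1)
    (hg : 1 / 2 ≤ q * g) (ha : (a : ℝ) ≤ g) (hj : q * j ≤ 2) :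
    (l - g) * (q * collisionBound q j a) + (g - a) * (q * collisionBound q j (a + 1)) ≤
      collisionBound q (j + 1) a := by
  have e1 : collisionBound q j (a + 1) = collisionBound q j a * Real.exp (-(q * j / 2)) := by
    rw [collisionBound, collisionBound, ← Real.exp_add]
    congr 1
    push_cast
    ring
  have e2 : collisionBound q (j + 1) a =
      collisionBound q j a * Real.exp (-(q * (a / 2 + j / 8))) := by
    rw [collisionBound, collisionBound, ← Real.exp_add]
    congr 1
    push_cast
    ring
  have hpos : 0 < collisionBound q j a := Real.exp_pos _
  have hx0 : 0 ≤ q * j / 2 := by positivity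
  have hexp : Real.exp (-(q * j / 2)) ≤ 1 - q * j / 4 := by
    rw [Real.exp_neg, inv_le_comm₀ (Real.exp_pos _) (by linarith)]
    refine le_trans ?_ (Real.add_one_le_exp _)
    rw [inv_le_iff_one_le_mul₀ (by linarith)]
    nlinarith
  have hlow : 1 - q * (a / 2 + j / 8) ≤ Real.exp (-(q * (a / 2 + j / 8))) := by
    linarith [Real.add_one_le_exp (-(q * ((a : ℝ) / 2 + j / 8)))]
  have hqa : 0 ≤ q * (g - a) := mul_nonneg hq.le (by linarith)
  have hqa' : 0 ≤ q * (a : ℝ) := by positivity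
  have h1 := mul_le_mul_of_nonneg_left hexp hqa
  have h2 : (q * a) * (q * j) ≤ (q * a) * 2 := mul_le_mul_of_nonneg_left hj hqa'
  have h3 : (1 / 2) * (q * j) ≤ (q * g) * (q * j) :=
    mul_le_mul_of_nonneg_right hg (by positivity)
  have key : 1 - q * g + q * (g - a) * Real.exp (-(q * j / 2)) ≤
      Real.exp (-(q * (a / 2 + j / 8))) := by
    refine le_trans ?_ hlow
    nlinarith
  rw [e1, e2]
  calc _ = collisionBound q j a *
        (q * l - q * g + q * (g - a) * Real.exp (-(q * j / 2))) := by ring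
    _ ≤ _ := by
      rw [hl]
      exact mul_le_mul_of_nonneg_left key hpos.le

variable {α β : Type*}

/-- No point hits a cell of `Occ`, and no two points are in the same cell of `Good`. -/
def noCollision {ι : Type*} (f : α → β) (Good Occ : Finset β) : Set (ι → α) :=
  {W | (∀ i, f (W i) ∉ Occ) ∧ ∀ i k, i ≠ k → f (W i) = f (W k) → f (W i) ∉ Good}

/-- Induction on the number of points, revealing the first; arbitrary `Occ` records the good cells
already hit. Since `f` need not be measurable, only monotonicity, subadditivity and the product
formula for arbitrary rectangles are used. -/
theorem measure_noCollision_le [MeasurableSpace α] [Fintype β] [DecidableEq β] (ω : Measure α)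
    [IsProbabilityMeasure ω] (f : α → β) {q : ℝ} (hq : 0 < q) (hq1 : q * Fintype.card β = 1)
    (hf : ∀ c, ω (f ⁻¹' {c}) ≤ ENNReal.ofReal q) (Good : Finset β)
    (hG : 1 / 2 ≤ q * Good.card) (j : ℕ) (hj : q * j ≤ 2) (Occ : Finset β) (hO : Occ ⊆ Good) :
    Measure.pi (fun _ : Fin j => ω) (noCollision f Good Occ) ≤
      ENNReal.ofReal (collisionBound q j Occ.card) := by
  induction j generalizing Occ with
  | zero =>
    refine prob_le_one.trans ?_
    simp [collisionBound]
  | succ j ih =>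
    have hj' : q * j ≤ 2 := by
      refine le_trans ?_ hj
      exact mul_le_mul_of_nonneg_left (by push_cast; linarith) hq.le
    let A : Finset β → Set (Fin j → α) := fun Occ => noCollision f Good Occ
    let E : Set (α × (Fin j → α)) :=
      (⋃ c ∈ Goodᶜ, (f ⁻¹' {c}) ×ˢ A Occ) ∪
        ⋃ c ∈ Good \ Occ, (f ⁻¹' {c}) ×ˢ A (insert c Occ)
    have hsub : (noCollision f Good Occ : Set (Fin (j + 1) → α)) ⊆
        MeasurableEquiv.piFinSuccAbove (fun _ => α) 0 ⁻¹' E := by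
      rintro W ⟨h1, h2⟩
      have hA : ∀ i : Fin j, f (W i.succ) ∉ Occ := fun i => h1 _
      have hA' : ∀ i k : Fin j, i ≠ k → f (W i.succ) = f (W k.succ) → f (W i.succ) ∉ Good :=
        fun i k hik => h2 _ _ (fun h => hik (Fin.succ_injective _ h))
      by_cases hg : f (W 0) ∈ Good
      · right
        simp only [Set.mem_iUnion]
        refine ⟨f (W 0), Finset.mem_sdiff.2 ⟨hg, h1 0⟩, rfl, fun i => ?_, hA'⟩
        simp only [Finset.mem_insert, not_or]
        refine ⟨fun e => ?_, hA i⟩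
        exact h2 0 i.succ (Fin.succ_ne_zero i).symm e.symm hg
      · left
        simp only [Set.mem_iUnion]
        exact ⟨f (W 0), by simpa using hg, rfl, hA, hA'⟩
    have hcard : (Occ.card : ℝ) ≤ Good.card := by exact_mod_cast Finset.card_le_card hO
    have hcardβ : (Good.card : ℝ) ≤ Fintype.card β := by exact_mod_cast Finset.card_le_univ Good
    have hb1 : 0 ≤ q * collisionBound q j Occ.card := mul_nonneg hq.le (Real.exp_pos _).le
    have hb2 : 0 ≤ q * collisionBound q j (Occ.card + 1) := mul_nonneg hq.le (Real.exp_pos _).le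
    have hs1 : (ω.prod (Measure.pi fun _ : Fin j => ω)) (⋃ c ∈ Goodᶜ, (f ⁻¹' {c}) ×ˢ A Occ) ≤
        ENNReal.ofReal ((Fintype.card β - Good.card) * (q * collisionBound q j Occ.card)) := by
      calc _ ≤ ∑ c ∈ Goodᶜ, (ω.prod (Measure.pi fun _ : Fin j => ω)) ((f ⁻¹' {c}) ×ˢ A Occ) :=
            measure_biUnion_finset_le _ _
        _ ≤ ∑ _c ∈ Goodᶜ, ENNReal.ofReal (q * collisionBound q j Occ.card) := by
            refine Finset.sum_le_sum fun c _ => ?_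
            rw [Measure.prod_prod, ENNReal.ofReal_mul hq.le]
            exact mul_le_mul' (hf c) (ih hj' Occ hO)
        _ = _ := by
            rw [Finset.sum_const, ← ENNReal.ofReal_nsmul, nsmul_eq_mul, Finset.card_compl,
              Nat.cast_sub (Finset.card_le_univ Good)]
    have hs2 : (ω.prod (Measure.pi fun _ : Fin j => ω))
        (⋃ c ∈ Good \ Occ, (f ⁻¹' {c}) ×ˢ A (insert c Occ)) ≤
        ENNReal.ofReal ((Good.card - Occ.card) * (q * collisionBound q j (Occ.card + 1))) := by
      calc _ ≤ ∑ c ∈ Good \ Occ, (ω.prod (Measure.pi fun _ : Fin j => ω))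
            ((f ⁻¹' {c}) ×ˢ A (insert c Occ)) := measure_biUnion_finset_le _ _
        _ ≤ ∑ _c ∈ Good \ Occ, ENNReal.ofReal (q * collisionBound q j (Occ.card + 1)) := by
            refine Finset.sum_le_sum fun c hc => ?_
            obtain ⟨hc1, hc2⟩ := Finset.mem_sdiff.1 hc
            rw [Measure.prod_prod, ENNReal.ofReal_mul hq.le]
            refine mul_le_mul' (hf c) ?_
            have := ih hj' (insert c Occ) (Finset.insert_subset hc1 hO)
            rwa [Finset.card_insert_of_notMem hc2] at this
        _ = _ := by
            rw [Finset.sum_const, ← ENNReal.ofReal_nsmul, nsmul_eq_mul, Finset.card_sdiff_of_subset hO,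
              Nat.cast_sub (Finset.card_le_card hO)]
    calc _ ≤ Measure.pi (fun _ : Fin (j + 1) => ω)
          (MeasurableEquiv.piFinSuccAbove (fun _ => α) 0 ⁻¹' E) := measure_mono hsub
      _ = (ω.prod (Measure.pi fun _ : Fin j => ω)) E :=
          (measurePreserving_piFinSuccAbove (fun _ : Fin (j + 1) => ω) 0).measure_preimage_equiv E
      _ ≤ _ := (measure_union_le _ _).trans (add_le_add hs1 hs2)
      _ ≤ _ := by
          rw [← ENNReal.ofReal_add (mul_nonneg (by linarith) hb1) (mul_nonneg (by linarith) hb2)]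
          exact ENNReal.ofReal_le_ofReal (collisionBound_step hq hq1 hG hcard hj')

theorem map_comp_injective_pi [MeasurableSpace α] {ι ι' : Type*} [Fintype ι] [Fintype ι']
    (ω : Measure α) [IsProbabilityMeasure ω] (e : ι' → ι) (he : Function.Injective e) :
    (Measure.pi fun _ : ι => ω).map (fun W k => W (e k)) = Measure.pi fun _ : ι' => ω := by
  have h : iIndepFun (fun (i : ι) (W : ι → α) => W i) (Measure.pi fun _ : ι => ω) :=
    iIndepFun_pi (X := fun _ => id) (fun _ => aemeasurable_id)
  have h' := h.precomp he
  rw [iIndepFun_iff_map_fun_eq_pi_map (fun i => (measurable_pi_apply _).aemeasurable)] at h'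
  refine h'.trans ?_
  congr 1
  funext k
  exact (measurePreserving_eval (fun _ : ι => ω) (e k)).map_eq

/-- The collision bound for the points with index in a finite set `J`. -/
theorem measure_noCollision_subset_le [MeasurableSpace α] [Fintype β] [DecidableEq β] {ι : Type*}
    [Fintype ι] (ω : Measure α)
    [IsProbabilityMeasure ω] (f : α → β) {q : ℝ} (hq : 0 < q) (hq1 : q * Fintype.card β = 1)
    (hf : ∀ c, ω (f ⁻¹' {c}) ≤ ENNReal.ofReal q) (Good : Finset β)
    (hG : 1 / 2 ≤ q * Good.card) (M : ℕ) (hM : q * M ≤ 2) (J : Finset ι) (hJ : M ≤ J.card) :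
    Measure.pi (fun _ : ι => ω)
      {W | ∀ i ∈ J, ∀ k ∈ J, i ≠ k → f (W i) = f (W k) → f (W i) ∉ Good} ≤
      ENNReal.ofReal (collisionBound q M 0) := by
  obtain ⟨J', hJ'J, hJ'⟩ := Finset.exists_subset_card_eq hJ
  let e : Fin M → ι := fun k => (J'.equivFin.symm (Fin.cast hJ'.symm k) : ι)
  have he : Function.Injective e := by
    intro a b h
    simpa [e, Subtype.coe_inj] using h
  have heJ : ∀ k, e k ∈ J := fun k => hJ'J (Subtype.coe_prop _)
  calc _ ≤ Measure.pi (fun _ : ι => ω)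
        ((fun (W : ι → α) k => W (e k)) ⁻¹' noCollision f Good ∅) := by
        refine measure_mono fun W hW => ⟨by simp, fun i k hik => ?_⟩
        exact hW _ (heJ i) _ (heJ k) (fun h => hik (he h))
    _ ≤ (Measure.pi fun _ : ι => ω).map (fun W k => W (e k)) (noCollision f Good ∅) :=
        Measure.le_map_apply
          (measurable_pi_lambda _ fun k => measurable_pi_apply (e k)).aemeasurable _
    _ ≤ _ := by
        rw [map_comp_injective_pi ω e he]
        exact measure_noCollision_le ω f hq hq1 hf Good hG M hM ∅ (by simp)

end Collisions

/-! ### Resampling the points of a set -/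

section Resampling

variable {α ι : Type*}

open Classical in
/-- The points of the configuration `x` that are in `B` are replaced by those of `w`. -/
def resample (B : Set α) (x w : ι → α) : ι → α :=
  fun i => if x i ∈ B then w i else x i

-- For every event `E`, the new point contributes `ν(B) ν(E | B) = ν(E ∩ B)` and the retained point
-- `ν(E \ B)`.
open Classical in
theorem map_ite_prod_cond [MeasurableSpace α] (ν : Measure α) [IsProbabilityMeasure ν] {B : Set α}
    (hB : MeasurableSet B) (hB0 : ν B ≠ 0) :
    (ν.prod (ν[|B])).map (fun z => if z.1 ∈ B then z.2 else z.1) = ν := by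
  have := cond_isProbabilityMeasure hB0
  have hmeas : Measurable (fun z : α × α => if z.1 ∈ B then z.2 else z.1) :=
    Measurable.ite (measurable_fst hB) measurable_snd measurable_fst
  ext E hE
  rw [Measure.map_apply hmeas hE]
  have hpre : (fun z : α × α => if z.1 ∈ B then z.2 else z.1) ⁻¹' E =
      B ×ˢ E ∪ (E \ B) ×ˢ Set.univ := by
    ext z
    by_cases hz : z.1 ∈ B <;> simp [hz]
  rw [hpre, measure_union _ ((hE.diff hB).prod MeasurableSet.univ), Measure.prod_prod,
    Measure.prod_prod, measure_univ, mul_one, mul_comm, cond_mul_eq_inter hB, Set.inter_comm,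
    measure_inter_add_sdiff E hB]
  exact Set.disjoint_left.2 fun z h1 h2 => h2.1.2 h1.1

theorem measurable_resample [MeasurableSpace α] {B : Set α} (hB : MeasurableSet B) :
    Measurable (fun z : (ι → α) × (ι → α) => resample B z.1 z.2) := by
  classical
  refine measurable_pi_lambda _ fun i => ?_
  exact Measurable.ite (((measurable_pi_apply i).comp measurable_fst) hB)
    ((measurable_pi_apply i).comp measurable_snd) ((measurable_pi_apply i).comp measurable_fst)

theorem map_resample [MeasurableSpace α] [Fintype ι] (ν : Measure α) [IsProbabilityMeasure ν]
    {B : Set α} (hB : MeasurableSet B) (hB0 : ν B ≠ 0) :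
    ((Measure.pi fun _ : ι => ν).prod (Measure.pi fun _ : ι => ν[|B])).map
      (fun z => resample B z.1 z.2) = Measure.pi fun _ : ι => ν := by
  classical
  have := cond_isProbabilityMeasure hB0
  have hmeas : Measurable (fun z : α × α => if z.1 ∈ B then z.2 else z.1) :=
    Measurable.ite (measurable_fst hB) measurable_snd measurable_fst
  have h1 := (measurePreserving_arrowProdEquivProdArrow α α ι (fun _ => ν) (fun _ => ν[|B])).map_eq
  rw [← h1, Measure.map_map (measurable_resample hB) (MeasurableEquiv.measurable _)]
  have h2 := Measure.pi_map_pi (μ := fun _ : ι => ν.prod (ν[|B]))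
    (f := fun _ z => if z.1 ∈ B then z.2 else z.1)
    (hμ := fun _ => by rw [map_ite_prod_cond ν hB hB0]; infer_instance) (fun _ => hmeas.aemeasurable)
  rw [map_ite_prod_cond ν hB hB0] at h2
  exact h2

/-- An event has probability at most `δ` if, whatever the configuration, it has probability at
most `δ` after the points in `B` are resampled. -/
theorem measure_le_of_resample_le [MeasurableSpace α] [Fintype ι] (ν : Measure α)
    [IsProbabilityMeasure ν] {B : Set α} (hB : MeasurableSet B) (hB0 : ν B ≠ 0)
    {E : Set (ι → α)} (hE : MeasurableSet E) {δ : ENNReal}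
    (h : ∀ x, (Measure.pi fun _ : ι => ν[|B]) {w | resample B x w ∈ E} ≤ δ) :
    (Measure.pi fun _ : ι => ν) E ≤ δ := by
  have := cond_isProbabilityMeasure hB0
  rw [← map_resample ν hB hB0, Measure.map_apply (measurable_resample hB) hE,
    Measure.prod_apply (measurable_resample hB hE)]
  calc _ ≤ ∫⁻ _, δ ∂(Measure.pi fun _ : ι => ν) := lintegral_mono h
    _ = δ := by simp

end Resampling

/-! ### The number of points in a set -/

-- Exponential Markov inequality for `2^(-count)`, whose mean is `(1 - ν(B)/2)^|ι|`.
open Classical in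
theorem measure_card_lt_le {α ι : Type*} [MeasurableSpace α] [Fintype ι] (ν : Measure α)
    [IsProbabilityMeasure ν] {B : Set α} (hB : MeasurableSet B) (T : ℝ) :
    (Measure.pi fun _ : ι => ν).real {x | ((Finset.univ.filter fun i => x i ∈ B).card : ℝ) < T} ≤
      Real.exp (T * Real.log 2 - Fintype.card ι * ν.real B / 2) := by
  let g : α → ℝ := fun a => if a ∈ B then 1 / 2 else 1
  have hg : ∀ a, g a = 1 - B.indicator (fun _ => (1 / 2 : ℝ)) a := by
    intro a
    by_cases ha : a ∈ B
    · simp [g, ha]; norm_num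
    · simp [g, ha]
  have hgm : Measurable g := Measurable.ite hB measurable_const measurable_const
  have hg0 : ∀ a, 0 ≤ g a := fun a => by
    by_cases ha : a ∈ B <;> simp [g, ha]
  have hgint : ∫ a, g a ∂ν = 1 - ν.real B / 2 := by
    simp_rw [hg]
    rw [integral_sub (integrable_const _) ((integrable_const _).indicator hB),
      integral_indicator_const _ hB]
    simp
    ring
  have hgI : Integrable g ν := by
    refine Integrable.of_bound hgm.aestronglyMeasurable 1 (ae_of_all _ fun a => ?_)
    rw [Real.norm_of_nonneg (hg0 a)]
    by_cases ha : a ∈ B <;> simp [g, ha]; norm_num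
  have hint := integral_fintype_prod_eq_pow (ι := ι) (μ := ν) g
  have hprod : ∀ x : ι → α, ∏ i, g (x i) =
      Real.exp (-((Finset.univ.filter fun i => x i ∈ B).card * Real.log 2)) := by
    intro x
    simp only [g]
    rw [Finset.prod_ite, Finset.prod_const, Finset.prod_const_one, mul_one, Real.exp_neg,
      Real.exp_nat_mul, Real.exp_log two_pos, one_div, inv_pow]
  have hmarkov := mul_meas_ge_le_integral_of_nonneg (μ := Measure.pi fun _ : ι => ν)
    (f := fun x => ∏ i, g (x i)) (ae_of_all _ fun x => Finset.prod_nonneg fun i _ => hg0 _)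
    (Integrable.fintype_prod fun _ => hgI) (Real.exp (-(T * Real.log 2)))
  rw [hint, hgint] at hmarkov
  have hsub : {x : ι → α | ((Finset.univ.filter fun i => x i ∈ B).card : ℝ) < T} ⊆
      {x | Real.exp (-(T * Real.log 2)) ≤ ∏ i, g (x i)} := by
    intro x hx
    simp only [Set.mem_ofPred_eq] at hx ⊢
    rw [hprod, Real.exp_le_exp]
    have := mul_le_mul_of_nonneg_right hx.le (Real.log_pos one_lt_two).le
    linarith
  have h1 := measureReal_mono (μ := Measure.pi fun _ : ι => ν) hsub
  have hB1 : ν.real B ≤ 1 := measureReal_le_one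
  have h2 : (1 - ν.real B / 2) ^ Fintype.card ι ≤
      Real.exp (-(Fintype.card ι * ν.real B / 2)) := by
    calc _ ≤ Real.exp (-(ν.real B / 2)) ^ Fintype.card ι :=
          pow_le_pow_left₀ (by linarith) (by linarith [Real.add_one_le_exp (-(ν.real B / 2))]) _
      _ = _ := by rw [← Real.exp_nat_mul]; congr 1; ring
  have h3 := (mul_le_mul_of_nonneg_left h1 (Real.exp_pos (-(T * Real.log 2))).le).trans
    (hmarkov.trans h2)
  have h4 := mul_le_mul_of_nonneg_left h3 (Real.exp_pos (T * Real.log 2)).le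
  rw [← mul_assoc, ← Real.exp_add, ← Real.exp_add, add_neg_cancel, Real.exp_zero, one_mul] at h4
  rwa [sub_eq_add_neg]

/-! ### Signatures of the vertices in the core -/

section Core

variable {n : ℕ} {L r : ℝ}

/-- The vertices with position in the core. -/
def coreVertices (L r : ℝ) (x : Fin n → ℝ × ℝ) : Set (Fin n) :=
  {i | x i ∈ core L r}

theorem torusDist_le_of_abs_le {a ρ : ℝ} {p q : ℝ × ℝ} (hL : 0 < L) (ha : 2 * a ≤ L)
    (hρ0 : 0 ≤ ρ) (hρ : 2 * a ^ 2 ≤ ρ ^ 2) (h₁ : |p.1 - q.1| ≤ a) (h₂ : |p.2 - q.2| ≤ a) :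
    torusDist L p q ≤ ρ := by
  rw [torusDist, Real.sqrt_le_left hρ0,
    (AddCircle.norm_coe_eq_abs_iff L hL.ne').2 (by rw [abs_of_pos hL]; linarith),
    (AddCircle.norm_coe_eq_abs_iff L hL.ne').2 (by rw [abs_of_pos hL]; linarith)]
  nlinarith [abs_nonneg (p.1 - q.1), abs_nonneg (p.2 - q.2)]

theorem abs_sub_le_of_mem_Ico {a b s t : ℝ} (hs : s ∈ Set.Ico a b) (ht : t ∈ Set.Ico a b) :
    |s - t| ≤ b - a :=
  abs_le.2 ⟨by linarith [hs.1, ht.2], by linarith [hs.2, ht.1]⟩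

/-- The diagonal of the core is `2√2 r/5 < r`. -/
theorem coreVertices_clique (hr : 0 < r) (hL : 4 * r < L) (x : Fin n → ℝ × ℝ) :
    ∀ u ∈ coreVertices L r x, ∀ v ∈ coreVertices L r x, u ≠ v → (torusGraph L r x).Adj u v := by
  intro u hu v hv huv
  refine ⟨huv, torusDist_le_of_abs_le (a := 2 * r / 5) (by linarith) (by linarith) hr.le
    (by nlinarith) ?_ ?_⟩
  · exact (abs_sub_le_of_mem_Ico hu.1 hv.1).trans (by linarith)
  · exact (abs_sub_le_of_mem_Ico hu.2 hv.2).trans (by linarith)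

/-- Half the diagonal is `√2 ρ/5 < ρ/3`. -/
theorem coreVertices_subset_centralBall {ρ : ℝ} (hr : 0 < ρ) (hL : 4 * ρ < Real.sqrt n)
    (x : Fin n → ℝ × ℝ) : coreVertices (Real.sqrt n) ρ x ⊆ centralBall (ρ / 3) x := fun _ hi =>
  torusDist_le_of_abs_le (a := ρ / 5) (by linarith) (by linarith) (by linarith) (by nlinarith)
    (abs_sub_half_le hi.1) (abs_sub_half_le hi.2)

/-- The part of the torus within distance `r` of the vertices that can be reached from `s` by at
most `κ` steps outside the core. -/
def region (L r : ℝ) (x : Fin n → ℝ × ℝ) (s κ : Fin n) : Set (ℝ × ℝ) :=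
  discUnion L r (x '' {w | w ∉ coreVertices L r x ∧
    (outerGraph (torusGraph L r x) (coreVertices L r x)).edist s w ≤ ((κ : ℕ) : ℕ∞)})

/-- Moving core points within the core changes neither the outer graph nor the regions. The regions
can therefore be read off from `x` although the game is played on `y`. A sensor in the core is at
distance 1 from every other core vertex and distinguishes nothing further. -/
theorem exists_region_iff_imp_sameSignature (hr : 0 < r) (hL : 4 * r < L)
    {x y : Fin n → ℝ × ℝ} (hxy : ∀ i, x i ∉ core L r → y i = x i)
    (hy : ∀ i, x i ∈ core L r → y i ∈ core L r) (S : Finset (Fin n)) :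
    ∃ κ : Fin n → Fin n, ∀ i ∈ coreVertices L r x, ∀ j ∈ coreVertices L r x, i ∉ S → j ∉ S →
      (∀ s ∈ S, (y i ∈ region L r x s (κ s) ↔ y j ∈ region L r x s (κ s))) →
      SameSignature (torusGraph L r y) S i j := by
  classical
  have hI : coreVertices L r y = coreVertices L r x := by
    ext i
    refine ⟨fun h => ?_, hy i⟩
    by_contra h'
    have h2 : y i ∈ core L r := h
    rw [hxy i h'] at h2
    exact h' h2
  have hH : outerGraph (torusGraph L r y) (coreVertices L r x) =
      outerGraph (torusGraph L r x) (coreVertices L r x) := by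
    ext u v
    constructor
    · rintro ⟨⟨h1, h2⟩, hu, hv⟩
      exact ⟨⟨h1, by rwa [← hxy u hu, ← hxy v hv]⟩, hu, hv⟩
    · rintro ⟨⟨h1, h2⟩, hu, hv⟩
      exact ⟨⟨h1, by rwa [hxy u hu, hxy v hv]⟩, hu, hv⟩
  have hcl := coreVertices_clique hr hL y
  rw [hI] at hcl
  have hex : ∀ s : Fin n, ∃ κ : Fin n, s ∉ coreVertices L r x →
      ∀ i ∈ coreVertices L r x, ∀ j ∈ coreVertices L r x,
        (y i ∈ region L r x s κ ↔ y j ∈ region L r x s κ) →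
        (torusGraph L r y).edist s i = (torusGraph L r y).edist s j := by
    intro s
    by_cases hs : s ∈ coreVertices L r x
    · exact ⟨s, fun h => absurd hs h⟩
    · have : Nonempty (Fin n) := ⟨s⟩
      obtain ⟨κ, hκ⟩ := exists_level (torusGraph L r y) (coreVertices L r x) hcl s hs
      refine ⟨Fin.cast (Fintype.card_fin n) κ, fun _ i hi j hj hij => hκ i hi j hj ?_⟩
      have hreg : ∀ i ∈ coreVertices L r x, (y i ∈ region L r x s (Fin.cast (Fintype.card_fin n) κ) ↔
          ∃ w, w ∉ coreVertices L r x ∧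
            (outerGraph (torusGraph L r y) (coreVertices L r x)).edist s w ≤ ((κ : ℕ) : ℕ∞) ∧
            (torusGraph L r y).Adj w i) := by
        intro i hi
        rw [hH]
        constructor
        · rintro ⟨_, ⟨w, ⟨hw, hd⟩, rfl⟩, hdist⟩
          refine ⟨w, hw, hd, ?_, by rwa [hxy w hw]⟩
          rintro rfl
          exact hw hi
        · rintro ⟨w, hw, hd, -, hdist⟩
          exact ⟨_, ⟨w, ⟨hw, hd⟩, rfl⟩, by rwa [hxy w hw] at hdist⟩
      rw [← hreg i hi, ← hreg j hj]
      exact hij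
  choose κ hκ using hex
  refine ⟨κ, fun i hi j hj hiS hjS h s hs => ?_⟩
  by_cases hsI : s ∈ coreVertices L r x
  · have h1 : ∀ i ∈ coreVertices L r x, i ∉ S → (torusGraph L r y).edist s i = 1 := by
      intro i hi hiS
      refine SimpleGraph.edist_eq_one_iff_adj.2 (hcl s hsI i hi ?_)
      rintro rfl
      exact hiS hs
    rw [h1 i hi hiS, h1 j hj hjS]
  · exact hκ s hsI i hi j hj (h s hs)

theorem exists_mem_side (hr : 0 < r) {N : ℕ} (hN : 0 < N) {t : ℝ}
    (ht : t ∈ Set.Ico (L / 2 - r / 5) (L / 2 + r / 5)) : ∃ a : Fin N, t ∈ side L r N a := by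
  have hN0 : (0 : ℝ) < N := by exact_mod_cast hN
  have hε : 0 < 2 * r / 5 / N := by positivity
  have h0 : 0 ≤ (t - (L / 2 - r / 5)) / (2 * r / 5 / N) :=
    div_nonneg (by linarith [ht.1]) hε.le
  have h1 := Nat.floor_le h0
  have h2 := Nat.lt_floor_add_one ((t - (L / 2 - r / 5)) / (2 * r / 5 / N))
  rw [le_div_iff₀ hε] at h1
  rw [div_lt_iff₀ hε] at h2
  have hlt : ⌊(t - (L / 2 - r / 5)) / (2 * r / 5 / N)⌋₊ < N := by
    rw [Nat.floor_lt h0, div_lt_iff₀ hε]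
    have : (N : ℝ) * (2 * r / 5 / N) = 2 * r / 5 := by field_simp
    linarith [ht.2]
  exact ⟨⟨_, hlt⟩, by simp only; linarith, by simp only; linarith⟩

theorem exists_mem_cell (hr : 0 < r) {N : ℕ} (hN : 0 < N) {p : ℝ × ℝ} (hp : p ∈ core L r) :
    ∃ c : Fin N × Fin N, p ∈ cell L r N c := by
  obtain ⟨a, ha⟩ := exists_mem_side hr hN hp.1
  obtain ⟨b, hb⟩ := exists_mem_side hr hN hp.2
  exact ⟨(a, b), ha, hb⟩

theorem exists_cell_map (hr : 0 < r) {N : ℕ} (hN : 0 < N) :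
    ∃ f : ℝ × ℝ → Fin N × Fin N, ∀ p ∈ core L r, p ∈ cell L r N (f p) := by
  have : ∀ p, ∃ c : Fin N × Fin N, p ∈ core L r → p ∈ cell L r N c := by
    intro p
    by_cases hp : p ∈ core L r
    · obtain ⟨c, hc⟩ := exists_mem_cell hr hN hp
      exact ⟨c, fun _ => hc⟩
    · exact ⟨(⟨0, hN⟩, ⟨0, hN⟩), fun h => absurd h hp⟩
  choose f hf using this
  exact ⟨f, hf⟩

/-! ### Measures of the core and of the cells -/

theorem measurableSet_core : MeasurableSet (core L r) :=
  measurableSet_Ico.prod measurableSet_Ico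

theorem volume_core : volume (core L r) = ENNReal.ofReal (2 * r / 5) * ENNReal.ofReal (2 * r / 5) := by
  rw [core, Measure.volume_eq_prod, Measure.prod_prod, Real.volume_Ico]
  ring_nf

theorem volume_cell {N : ℕ} (c : Fin N × Fin N) : volume (cell L r N c) =
    ENNReal.ofReal (2 * r / 5 / N) * ENNReal.ofReal (2 * r / 5 / N) := by
  rw [cell, Measure.volume_eq_prod, Measure.prod_prod, side, side, Real.volume_Ico, Real.volume_Ico]
  ring_nf

theorem core_subset_square {ρ : ℝ} (hr : 0 < ρ) (hL : 4 * ρ < Real.sqrt n) :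
    core (Real.sqrt n) ρ ⊆ square n := by
  have h : Set.Ico (Real.sqrt n / 2 - ρ / 5) (Real.sqrt n / 2 + ρ / 5) ⊆
      Set.Icc 0 (Real.sqrt n) := fun t ht => ⟨by linarith [ht.1], by linarith [ht.2]⟩
  exact Set.prod_mono h h

theorem volume_square (n : ℕ) : volume (square n) = n := by
  rw [square, Measure.volume_eq_prod, Measure.prod_prod, Real.volume_Icc, sub_zero,
    ← ENNReal.ofReal_mul (Real.sqrt_nonneg _), Real.mul_self_sqrt (Nat.cast_nonneg n),
    ENNReal.ofReal_natCast]

theorem measurableSet_square (n : ℕ) : MeasurableSet (square n) :=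
  measurableSet_Icc.prod measurableSet_Icc

theorem isProbabilityMeasure_cond_square (hn : 0 < n) :
    IsProbabilityMeasure ((volume : Measure (ℝ × ℝ))[|square n]) :=
  cond_isProbabilityMeasure_of_finite (by rw [volume_square]; exact_mod_cast hn.ne')
    (by rw [volume_square]; exact ENNReal.natCast_ne_top n)

theorem cond_square_core {ρ : ℝ} (hr : 0 < ρ) (hL : 4 * ρ < Real.sqrt n) :
    ((volume : Measure (ℝ × ℝ))[|square n]) (core (Real.sqrt n) ρ) =
      ENNReal.ofReal ((2 * ρ / 5) ^ 2 / n) := by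
  have hn : (0 : ℝ) < n := Real.sqrt_pos.1 (by linarith)
  rw [cond_apply (measurableSet_square n), Set.inter_eq_self_of_subset_right (core_subset_square hr hL),
    volume_square, volume_core, ← ENNReal.ofReal_mul (by positivity), ENNReal.ofReal_div_of_pos hn,
    ENNReal.ofReal_natCast, mul_comm, ← sq, div_eq_mul_inv (ENNReal.ofReal _)]

theorem cond_core_preimage_le {ρ : ℝ} (hr : 0 < ρ) (hL : 4 * ρ < Real.sqrt n) {N : ℕ} (hN : 0 < N)
    {f : ℝ × ℝ → Fin N × Fin N}
    (hf : ∀ p ∈ core (Real.sqrt n) ρ, p ∈ cell (Real.sqrt n) ρ N (f p)) (c : Fin N × Fin N) :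
    ((volume : Measure (ℝ × ℝ))[|square n])[|core (Real.sqrt n) ρ] (f ⁻¹' {c}) ≤
      ENNReal.ofReal (1 / (N : ℝ) ^ 2) := by
  have hN0 : (0 : ℝ) < N := by exact_mod_cast hN
  have hn : (0 : ℝ) < n := Real.sqrt_pos.1 (by linarith)
  rw [cond_apply measurableSet_core, cond_square_core hr hL]
  have hsub : core (Real.sqrt n) ρ ∩ f ⁻¹' {c} ⊆ cell (Real.sqrt n) ρ N c := by
    rintro p ⟨hp, rfl⟩
    exact hf p hp
  calc _ ≤ (ENNReal.ofReal ((2 * ρ / 5) ^ 2 / n))⁻¹ *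
        ((volume : Measure (ℝ × ℝ))[|square n]) (cell (Real.sqrt n) ρ N c) := by gcongr
    _ = ENNReal.ofReal (1 / (N : ℝ) ^ 2) := by
      rw [cond_apply (measurableSet_square n), Set.inter_eq_self_of_subset_right
          ((cell_subset_core hr c).trans (core_subset_square hr hL)),
        volume_square, volume_cell, ← ENNReal.ofReal_natCast, ← ENNReal.ofReal_inv_of_pos hn,
        ← ENNReal.ofReal_inv_of_pos (by positivity), ← ENNReal.ofReal_mul (by positivity),
        ← ENNReal.ofReal_mul (by positivity), ← ENNReal.ofReal_mul (by positivity)]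
      congr 1
      field_simp

end Core

/-! ### Configurations without a pair of core vertices of equal signature -/

section Bad

variable {n : ℕ} {L r : ℝ}

/-- There are at least `T` core vertices, and some `m` sensors distinguish all of them. -/
def separated (n : ℕ) (L r : ℝ) (T m : ℕ) : Set (Fin n → ℝ × ℝ) :=
  {x | T ≤ (coreVertices L r x).ncard ∧ ∃ S : Finset (Fin n), S.card ≤ m ∧
    ∀ i ∈ coreVertices L r x, ∀ j ∈ coreVertices L r x, i ≠ j →
      ¬ SameSignature (torusGraph L r x) S i j}

theorem measurable_torusDist_apply (i j : Fin n) :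
    Measurable fun x : Fin n → ℝ × ℝ => torusDist L (x i) (x j) := by
  have h : Measurable fun t : ℝ => ‖(t : AddCircle L)‖ :=
    (continuous_norm.comp (AddCircle.continuous_mk' L)).measurable
  have h₁ : Measurable fun x : Fin n → ℝ × ℝ => (x i).1 - (x j).1 :=
    (measurable_pi_apply i).fst.sub (measurable_pi_apply j).fst
  have h₂ : Measurable fun x : Fin n → ℝ × ℝ => (x i).2 - (x j).2 :=
    (measurable_pi_apply i).snd.sub (measurable_pi_apply j).snd
  exact (((h.comp h₁).pow_const 2).add ((h.comp h₂).pow_const 2)).sqrt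

/-- The event depends on `x` only through finitely many truth values, adjacencies and core
memberships, each measurable. -/
theorem measurableSet_separated (T m : ℕ) : MeasurableSet (separated n L r T m) := by
  let h : (Fin n → ℝ × ℝ) → (Fin n × Fin n → Prop) × (Fin n → Prop) := fun x =>
    (fun e => torusDist L (x e.1) (x e.2) ≤ r, fun i => x i ∈ core L r)
  have hm : Measurable h := by
    refine Measurable.prodMk (measurable_pi_lambda _ fun e => ?_) (measurable_pi_lambda _ fun i => ?_)
    · exact measurableSet_setOfPred.1 (measurableSet_le (measurable_torusDist_apply e.1 e.2)
        measurable_const)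
    · exact measurableSet_setOfPred.1 (measurable_pi_apply i measurableSet_core)
  have hpre : separated n L r T m = h ⁻¹' (h '' separated n L r T m) := by
    refine Set.Subset.antisymm (Set.subset_preimage_image _ _) ?_
    rintro y ⟨x, hx, hxy⟩
    have h1 : torusGraph L r x = torusGraph L r y := by
      ext i j
      have := congrFun (congrArg Prod.fst hxy) (i, j)
      simp only [h, eq_iff_iff] at this
      simp only [torusGraph, this]
    have h2 : coreVertices L r x = coreVertices L r y := by
      ext i
      have := congrFun (congrArg Prod.snd hxy) i
      simp only [h, eq_iff_iff] at this
      exact this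
    have hx' : T ≤ (coreVertices L r x).ncard ∧ ∃ S : Finset (Fin n), S.card ≤ m ∧
      ∀ i ∈ coreVertices L r x, ∀ j ∈ coreVertices L r x, i ≠ j →
        ¬ SameSignature (torusGraph L r x) S i j := hx
    rw [h1, h2] at hx'
    exact hx'
  rw [hpre]
  exact hm (Set.toFinite _).measurableSet

/-- The cells that are cut by none of the given regions. -/
def goodCells (L r : ℝ) (N : ℕ) (x : Fin n → ℝ × ℝ) {m : ℕ} (t : Fin m → Fin n × Fin n) :
    Set (Fin N × Fin N) :=
  {c | ∀ l, ¬ Cuts (region L r x (t l).1 (t l).2) (cell L r N c)}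

theorem le_ncard_goodCells (hr : 0 < r) (hL : 4 * r < L) {N m : ℕ} (hN : 40 ≤ N)
    (hNm : 24 * m ≤ N) (x : Fin n → ℝ × ℝ) (t : Fin m → Fin n × Fin n) :
    N ^ 2 ≤ 2 * (goodCells L r N x t).ncard := by
  have hcompl : (goodCells L r N x t)ᶜ ⊆
      ⋃ l ∈ (Finset.univ : Finset (Fin m)),
        {c | Cuts (region L r x (t l).1 (t l).2) (cell L r N c)} := by
    intro c hc
    simp only [goodCells, Set.mem_compl_iff, Set.mem_ofPred_eq, not_forall, not_not] at hc
    simpa using hc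
  have h1 : (goodCells L r N x t)ᶜ.ncard ≤ m * (12 * N) := by
    calc _ ≤ _ := Set.ncard_le_ncard hcompl (Set.toFinite _)
      _ ≤ ∑ l : Fin m, {c | Cuts (region L r x (t l).1 (t l).2) (cell L r N c)}.ncard :=
        Finset.set_ncard_biUnion_le _ _
      _ ≤ ∑ _l : Fin m, 12 * N := Finset.sum_le_sum fun l _ => ncard_cuts_le hr hL hN _
      _ = m * (12 * N) := by simp
  have h2 := Set.ncard_add_ncard_compl (goodCells L r N x t)
  rw [Nat.card_eq_fintype_card, Fintype.card_prod, Fintype.card_fin] at h2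
  have h3 : 24 * m * N ≤ N * N := Nat.mul_le_mul_right N hNm
  nlinarith

/-- Padding to exactly `m` slots lets the union bound run over the functions `Fin m → Fin n × Fin
n`. -/
theorem exists_fin_map_covering (hn : 0 < n) {m : ℕ} (S : Finset (Fin n)) (hS : S.card ≤ m) :
    ∃ u : Fin m → Fin n, ∀ s ∈ S, ∃ l, u l = s := by
  refine ⟨fun l => if h : (l : ℕ) < S.card then S.equivFin.symm ⟨l, h⟩ else ⟨0, hn⟩,
    fun s hs => ?_⟩
  refine ⟨⟨S.equivFin ⟨s, hs⟩, (S.equivFin ⟨s, hs⟩).isLt.trans_le hS⟩, ?_⟩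
  simp

theorem sameSignature_of_mem_goodCell (hr : 0 < r) (hL : 4 * r < L) (hn : 0 < n) {N m : ℕ}
    {x y : Fin n → ℝ × ℝ} (hxy : ∀ i, x i ∉ core L r → y i = x i)
    (hy : ∀ i, x i ∈ core L r → y i ∈ core L r) (S : Finset (Fin n)) (hS : S.card ≤ m) :
    ∃ t : Fin m → Fin n × Fin n, ∀ i ∈ coreVertices L r x, ∀ j ∈ coreVertices L r x,
      (∀ l, (t l).1 ≠ i) → (∀ l, (t l).1 ≠ j) → ∀ c ∈ goodCells L r N x t,
      y i ∈ cell L r N c → y j ∈ cell L r N c → SameSignature (torusGraph L r y) S i j := by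
  obtain ⟨κ, hκ⟩ := exists_region_iff_imp_sameSignature hr hL hxy hy S
  obtain ⟨u, hu⟩ := exists_fin_map_covering hn S hS
  refine ⟨fun l => (u l, κ (u l)), fun i hi j hj hti htj c hc hic hjc => hκ i hi j hj ?_ ?_ ?_⟩
  · intro h
    obtain ⟨l, hl⟩ := hu i h
    exact hti l hl
  · intro h
    obtain ⟨l, hl⟩ := hu j h
    exact htj l hl
  · intro s hs
    obtain ⟨l, rfl⟩ := hu s hs
    have hl := hc l
    constructor
    · intro h
      by_contra h'
      exact hl ⟨⟨_, hic, h⟩, _, hjc, h'⟩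
    · intro h
      by_contra h'
      exact hl ⟨⟨_, hjc, h⟩, _, hic, h'⟩

/-- Fix `x` and resample its core points. The regions do not depend on the resampling, so a union
bound over the `(n²)^m` families, with the collision bound for each, gives the estimate. -/
theorem pointsLaw_separated_le {ρ : ℝ} (hr : 0 < ρ) (hL : 4 * ρ < Real.sqrt n) {N m M : ℕ}
    (hN : 40 ≤ N) (hNm : 24 * m ≤ N) (hM : M ≤ 2 * N ^ 2) :
    pointsLaw n (separated n (Real.sqrt n) ρ (M + m) m) ≤
      ENNReal.ofReal (((n : ℝ) * n) ^ m * collisionBound (1 / (N : ℝ) ^ 2) M 0) := by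
  classical
  have hn : (0 : ℝ) < n := Real.sqrt_pos.1 (by linarith)
  have hn' : 0 < n := by exact_mod_cast hn
  have hN0 : (0 : ℝ) < N := by exact_mod_cast (show 0 < N by omega)
  set B := core (Real.sqrt n) ρ with hBdef
  have := isProbabilityMeasure_cond_square hn'
  have hB0 : ((volume : Measure (ℝ × ℝ))[|square n]) B ≠ 0 := by
    rw [cond_square_core hr hL]
    exact (ENNReal.ofReal_pos.2 (by positivity)).ne'
  refine measure_le_of_resample_le _ measurableSet_core hB0 (measurableSet_separated _ _)
    fun x => ?_
  have hω := cond_isProbabilityMeasure hB0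
  set ω := ((volume : Measure (ℝ × ℝ))[|square n])[|B] with hωdef
  obtain ⟨f, hf⟩ := exists_cell_map (L := Real.sqrt n) hr (N := N) (by omega)
  let I : Finset (Fin n) := Finset.univ.filter fun i => x i ∈ B
  have hI : ∀ i, i ∈ I ↔ x i ∈ B := fun i => by simp [I]
  -- Core vertices that carry sensors are discarded. There are at most `m`, so the threshold `M + m`
  -- leaves `M` points.
  let J : (Fin m → Fin n × Fin n) → Finset (Fin n) := fun t =>
    I \ Finset.univ.image fun l => (t l).1
  let F : (Fin m → Fin n × Fin n) → Set (Fin n → ℝ × ℝ) := fun t =>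
    {w | M + m ≤ I.card ∧ ∀ i ∈ J t, ∀ k ∈ J t, i ≠ k → f (w i) = f (w k) →
      f (w i) ∉ (goodCells (Real.sqrt n) ρ N x t).toFinset}
  have hsub : {w | resample B x w ∈ separated n (Real.sqrt n) ρ (M + m) m} ⊆
      (⋃ i, (fun w : Fin n → ℝ × ℝ => w i) ⁻¹' Bᶜ) ∪ ⋃ t ∈ (Finset.univ : Finset _), F t := by
    rintro w ⟨hcard, S, hS, hsep⟩
    by_cases hw : ∃ i, w i ∉ B
    · left
      simpa using hw
    · right
      push Not at hw
      have hxy : ∀ i, x i ∉ B → resample B x w i = x i := fun i hi => by simp [resample, hi]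
      have hyw : ∀ i, x i ∈ B → resample B x w i = w i := fun i hi => by simp [resample, hi]
      have hcore : coreVertices (Real.sqrt n) ρ (resample B x w) = (I : Set (Fin n)) := by
        ext i
        rw [Finset.mem_coe, hI]
        change resample B x w i ∈ B ↔ _
        by_cases hi : x i ∈ B
        · rw [hyw i hi]
          exact iff_of_true (hw i) hi
        · rw [hxy i hi]
      rw [hcore] at hsep hcard
      rw [Set.ncard_coe_finset] at hcard
      obtain ⟨t, ht⟩ := sameSignature_of_mem_goodCell (N := N) hr hL hn' hxy
        (fun i hi => by rw [hyw i hi]; exact hw i) S hS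
      simp only [Finset.mem_univ, Set.iUnion_true, Set.mem_iUnion]
      refine ⟨t, hcard, fun i hi k hk hik he hgood => ?_⟩
      obtain ⟨hiI, hit⟩ := Finset.mem_sdiff.1 hi
      obtain ⟨hkI, hkt⟩ := Finset.mem_sdiff.1 hk
      have hiB := (hI i).1 hiI
      have hkB := (hI k).1 hkI
      refine hsep i hiI k hkI hik (ht i hiB k hkB ?_ ?_ _ (Set.mem_toFinset.1 hgood) ?_ ?_)
      · intro l hl
        exact hit (Finset.mem_image.2 ⟨l, Finset.mem_univ _, hl⟩)
      · intro l hl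
        exact hkt (Finset.mem_image.2 ⟨l, Finset.mem_univ _, hl⟩)
      · rw [hyw i hiB]
        exact hf _ (hw i)
      · rw [hyw k hkB, he]
        exact hf _ (hw k)
  have hnull : (Measure.pi fun _ : Fin n => ω) (⋃ i, (fun w : Fin n → ℝ × ℝ => w i) ⁻¹' Bᶜ) = 0 := by
    refine measure_iUnion_null fun i => ?_
    rw [(measurePreserving_eval (fun _ : Fin n => ω) i).measure_preimage
      measurableSet_core.compl.nullMeasurableSet, hωdef, cond_apply measurableSet_core]
    simp
  have hF : ∀ t, (Measure.pi fun _ : Fin n => ω) (F t) ≤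
      ENNReal.ofReal (collisionBound (1 / (N : ℝ) ^ 2) M 0) := by
    intro t
    by_cases hcard : M + m ≤ I.card
    · have hJ : M ≤ (J t).card := by
        have h1 := Finset.le_card_sdiff (Finset.univ.image fun l => (t l).1) I
        have h2 : (Finset.univ.image fun l => (t l).1).card ≤ m :=
          Finset.card_image_le.trans (by simp)
        simp only [J]
        omega
      refine (measure_mono fun w hw => hw.2).trans
        (measure_noCollision_subset_le ω f (by positivity) ?_
          (cond_core_preimage_le hr hL (by omega) hf) _ ?_ M ?_ (J t) hJ)
      · rw [Fintype.card_prod, Fintype.card_fin]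
        push_cast
        field_simp
      · have h := le_ncard_goodCells hr hL hN hNm x t
        rw [← Set.ncard_eq_toFinset_card']
        have h' : (N : ℝ) ^ 2 ≤ 2 * (goodCells (Real.sqrt n) ρ N x t).ncard := by exact_mod_cast h
        rw [one_div_mul_eq_div, le_div_iff₀ (by positivity)]
        linarith
      · have h' : (M : ℝ) ≤ 2 * (N : ℝ) ^ 2 := by exact_mod_cast hM
        rw [one_div_mul_eq_div, div_le_iff₀ (by positivity)]
        exact h'
    · have : F t = ∅ := Set.eq_empty_of_forall_notMem fun w hw => hcard hw.1
      rw [this]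
      simp
  calc _ ≤ _ := measure_mono hsub
    _ ≤ 0 + ∑ t : Fin m → Fin n × Fin n, ENNReal.ofReal (collisionBound (1 / (N : ℝ) ^ 2) M 0) := by
      refine (measure_union_le _ _).trans (add_le_add hnull.le ?_)
      exact (measure_biUnion_finset_le _ _).trans (Finset.sum_le_sum fun t _ => hF t)
    _ = _ := by
      rw [zero_add, Finset.sum_const, ← ENNReal.ofReal_nsmul, nsmul_eq_mul, Finset.card_univ,
        Fintype.card_fun, Fintype.card_prod, Fintype.card_fin, Fintype.card_fin]
      push_cast
      rfl

theorem pointsLaw_few_core_le {ρ T : ℝ} (hr : 0 < ρ) (hL : 4 * ρ < Real.sqrt n) :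
    pointsLaw n {x | ((coreVertices (Real.sqrt n) ρ x).ncard : ℝ) < T} ≤
      ENNReal.ofReal (Real.exp (T * Real.log 2 - (2 * ρ / 5) ^ 2 / 2)) := by
  classical
  have hn : (0 : ℝ) < n := Real.sqrt_pos.1 (by linarith)
  have := isProbabilityMeasure_cond_square (n := n) (by exact_mod_cast hn)
  have h := measure_card_lt_le (ι := Fin n) ((volume : Measure (ℝ × ℝ))[|square n])
    (measurableSet_core (L := Real.sqrt n) (r := ρ)) T
  have hset : {x : Fin n → ℝ × ℝ | ((coreVertices (Real.sqrt n) ρ x).ncard : ℝ) < T} =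
      {x | ((Finset.univ.filter fun i => x i ∈ core (Real.sqrt n) ρ).card : ℝ) < T} := by
    ext x
    have : coreVertices (Real.sqrt n) ρ x =
        ((Finset.univ.filter fun i => x i ∈ core (Real.sqrt n) ρ : Finset (Fin n)) : Set _) := by
      ext i
      simp [coreVertices]
    simp only [Set.mem_ofPred_eq]
    rw [this, Set.ncard_coe_finset]
  have hreal : ((volume : Measure (ℝ × ℝ))[|square n]).real (core (Real.sqrt n) ρ) =
      (2 * ρ / 5) ^ 2 / n := by
    rw [Measure.real, cond_square_core hr hL, ENNReal.toReal_ofReal (by positivity)]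
  rw [hreal, Fintype.card_fin, mul_div_cancel₀ _ hn.ne'] at h
  rw [hset, pointsLaw]
  exact (ENNReal.le_ofReal_iff_toReal_le (measure_ne_top _ _) (Real.exp_pos _).le).2 h

end Bad

/-! ### The conclusion -/

theorem robberEvadesIn_of_notMem_separated {n m T : ℕ} {ρ K : ℝ} (hr : 0 < ρ)
    (hL : 4 * ρ < Real.sqrt n) (hn : 0 < n) (hm : K ≤ m) {x : Fin n → ℝ × ℝ}
    (hT : T ≤ (coreVertices (Real.sqrt n) ρ x).ncard)
    (hx : x ∉ separated n (Real.sqrt n) ρ T m) :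
    RobberEvadesIn (torusGraph (Real.sqrt n) ρ x) K (centralBall (ρ / 3) x) := by
  have : Nonempty (Fin n) := ⟨⟨0, hn⟩⟩
  refine RobberEvadesIn.of_clique (coreVertices_subset_centralBall hr hL x)
    (coreVertices_clique hr hL x) fun S hS => ?_
  by_contra h
  push Not at h
  exact hx ⟨hT, S, by exact_mod_cast hS.le.trans hm, h⟩

/-! ### Arithmetic of the sensor bound and choice of parameters -/

/-- The bound on the number of sensors. -/
def sensorBound (l ρ : ℝ) : ℝ :=
  (10 : ℝ) ^ (-4 : ℤ) * ρ ^ ((4 : ℝ) / 3) / l ^ ((1 : ℝ) / 3)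

theorem sensorBound_pow_three_mul {l ρ : ℝ} (hl : 0 < l) (hρ : 0 < ρ) :
    (10 : ℝ) ^ 12 * (sensorBound l ρ ^ 3 * l) = ρ ^ 4 := by
  have h1 : (ρ ^ ((4 : ℝ) / 3)) ^ 3 = ρ ^ 4 := by
    rw [← Real.rpow_natCast, ← Real.rpow_mul hρ.le, ← Real.rpow_natCast]
    norm_num
  have h2 : (l ^ ((1 : ℝ) / 3)) ^ 3 = l := by
    rw [← Real.rpow_natCast, ← Real.rpow_mul hl.le]
    norm_num
  rw [sensorBound, div_pow, mul_pow, h1, h2]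
  field_simp

/-- From `l ≤ ρ`, `(10⁴K)³ = ρ⁴/l ≥ ρ³`. This makes `K` large and secures `M ≤ 2N²`. -/
theorem le_sensorBound {l ρ : ℝ} (hl : 0 < l) (hlρ : l ≤ ρ) :
    ρ ≤ 10000 * sensorBound l ρ := by
  have hρ : 0 < ρ := hl.trans_le hlρ
  have h := sensorBound_pow_three_mul hl hρ
  have hK : 0 < sensorBound l ρ := by unfold sensorBound; positivity
  by_contra hlt
  push Not at hlt
  have h1 : (10000 * sensorBound l ρ) ^ 3 < ρ ^ 3 := pow_lt_pow_left₀ hlt (by positivity) (by norm_num)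
  have h2 : (10000 * sensorBound l ρ) ^ 3 * l < ρ ^ 3 * ρ :=
    mul_lt_mul h1 hlρ hl (by positivity)
  nlinarith

/-- From `l ≥ 1`, `(10⁴K)³ ≤ ρ⁴ ≤ ρ⁶`. Sensors are thus few compared with core points. -/
theorem sensorBound_le {l ρ : ℝ} (hl : 1 ≤ l) (hlρ : l ≤ ρ) :
    10000 * sensorBound l ρ ≤ ρ ^ 2 := by
  have hl0 : 0 < l := by linarith
  have hρ : 1 ≤ ρ := hl.trans hlρ
  have h := sensorBound_pow_three_mul hl0 (by linarith : 0 < ρ)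
  have hK : 0 < sensorBound l ρ := by
    have : 0 < ρ := by linarith
    unfold sensorBound
    positivity
  by_contra hlt
  push Not at hlt
  have h1 : (ρ ^ 2) ^ 3 < (10000 * sensorBound l ρ) ^ 3 :=
    pow_lt_pow_left₀ hlt (by positivity) (by norm_num)
  have h2 : (10000 * sensorBound l ρ) ^ 3 * 1 ≤ (10000 * sensorBound l ρ) ^ 3 * l :=
    mul_le_mul_of_nonneg_left hl (by positivity)
  have h3 : ρ ^ 4 ≤ ρ ^ 6 := pow_le_pow_right₀ hρ (by norm_num)
  nlinarith

theorem pointsLaw_not_evades_le {n : ℕ} {ρ : ℝ} (hl : (10 : ℝ) ^ 6 ≤ Real.log n)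
    (hlρ : Real.log n ≤ ρ) (hL : ρ < Real.sqrt n / 4) :
    pointsLaw n {x | RobberEvadesIn (torusGraph (Real.sqrt n) ρ x)
      (sensorBound (Real.log n) ρ) (centralBall (ρ / 3) x)}ᶜ ≤
      ENNReal.ofReal (2 * Real.exp (-Real.log n)) := by
  set l := Real.log n with hldef
  set K := sensorBound l ρ with hKdef
  have hl0 : 0 < l := by linarith
  have hρ0 : 0 < ρ := by linarith
  have hL' : 4 * ρ < Real.sqrt n := by linarith
  have hn : (0 : ℝ) < n := Real.sqrt_pos.1 (by linarith)
  have hρ6 : (10 : ℝ) ^ 6 ≤ ρ := hl.trans hlρ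
  have hK1 := le_sensorBound hl0 hlρ
  have hK2 := sensorBound_le (by linarith) hlρ
  have hK3 := sensorBound_pow_three_mul hl0 hρ0
  rw [← hKdef] at hK1 hK2 hK3
  have hK100 : 100 ≤ K := by linarith
  obtain ⟨hm1, hm2⟩ : K ≤ ⌈K⌉₊ ∧ (⌈K⌉₊ : ℝ) < K + 1 :=
    ⟨Nat.le_ceil _, Nat.ceil_lt_add_one (by linarith)⟩
  -- The factor 4000 makes `N` large enough for `M ≤ 2N²` and still small enough for `M(M-1)/(16N²)
  -- ≥ 7Kl`.
  obtain ⟨hN1, hN2⟩ : 4000 * K ≤ ⌈4000 * K⌉₊ ∧ (⌈4000 * K⌉₊ : ℝ) < 4000 * K + 1 :=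
    ⟨Nat.le_ceil _, Nat.ceil_lt_add_one (by linarith)⟩
  obtain ⟨hM1, hM2⟩ : ρ ^ 2 / 20 ≤ ⌈ρ ^ 2 / 20⌉₊ ∧ (⌈ρ ^ 2 / 20⌉₊ : ℝ) < ρ ^ 2 / 20 + 1 :=
    ⟨Nat.le_ceil _, Nat.ceil_lt_add_one (by positivity)⟩
  generalize ⌈K⌉₊ = m at hm1 hm2
  generalize ⌈4000 * K⌉₊ = N at hN1 hN2
  generalize ⌈ρ ^ 2 / 20⌉₊ = M at hM1 hM2
  have hρsq : (10 : ℝ) ^ 6 * ρ ≤ ρ ^ 2 := by nlinarith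
  have hN40 : 40 ≤ N := by
    have : (40 : ℝ) ≤ N := by linarith
    exact_mod_cast this
  have hNm : 24 * m ≤ N := by
    have : (24 : ℝ) * m ≤ N := by linarith
    exact_mod_cast this
  have hNsq : 16000000 * K ^ 2 ≤ (N : ℝ) ^ 2 := by
    have := pow_le_pow_left₀ (by positivity) hN1 2
    linarith
  have hρK : ρ ^ 2 ≤ 100000000 * K ^ 2 := by
    have := pow_le_pow_left₀ hρ0.le hK1 2
    linarith
  have hMN : M ≤ 2 * N ^ 2 := by
    have : (M : ℝ) ≤ 2 * (N : ℝ) ^ 2 := by linarith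
    exact_mod_cast this
  have hfew := pointsLaw_few_core_le (T := (M + m : ℕ)) hρ0 hL'
  have hsep := pointsLaw_separated_le hρ0 hL' hN40 hNm hMN
  have hcover : {x | RobberEvadesIn (torusGraph (Real.sqrt n) ρ x) K (centralBall (ρ / 3) x)}ᶜ ⊆
      {x | ((coreVertices (Real.sqrt n) ρ x).ncard : ℝ) < (M + m : ℕ)} ∪
        separated n (Real.sqrt n) ρ (M + m) m := by
    intro x hx
    by_contra h
    simp only [Set.mem_union, not_or, Set.mem_ofPred_eq, not_lt] at h
    exact hx (robberEvadesIn_of_notMem_separated hρ0 hL' (by exact_mod_cast hn) hm1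
      (by exact_mod_cast h.1) h.2)
  have hexp1 : Real.exp ((M + m : ℕ) * Real.log 2 - (2 * ρ / 5) ^ 2 / 2) ≤ Real.exp (-l) := by
    rw [Real.exp_le_exp]
    have hlog := Real.log_two_lt_d9
    have hlog0 := Real.log_pos one_lt_two
    -- The right side is half the expected number `4ρ²/25` of core points.
    have hT : ((M + m : ℕ) : ℝ) ≤ 2 * ρ ^ 2 / 25 := by
      push_cast
      linarith
    have h1 : ((M + m : ℕ) : ℝ) * Real.log 2 ≤ 2 * ρ ^ 2 / 25 * (7 / 10) :=
      mul_le_mul hT (by linarith) hlog0.le (by positivity)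
    nlinarith
  have hexp2 : ((n : ℝ) * n) ^ m * collisionBound (1 / (N : ℝ) ^ 2) M 0 ≤ Real.exp (-l) := by
    have hnexp : (n : ℝ) = Real.exp l := (Real.exp_log hn).symm
    have hpow : ((n : ℝ) * n) ^ m = Real.exp (m * (l + l)) := by
      rw [Real.exp_nat_mul, Real.exp_add, ← hnexp]
    rw [hpow, collisionBound, ← Real.exp_add, Real.exp_le_exp]
    have hNK : (N : ℝ) ^ 2 ≤ 17000000 * K ^ 2 := by
      have := pow_le_pow_left₀ (by positivity) hN2.le 2
      nlinarith
    have hNpos : 0 < (N : ℝ) ^ 2 := by nlinarith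
    have hMM : ρ ^ 4 / 500 ≤ (M : ℝ) * (M - 1) := by
      have h1 : ρ ^ 2 / 20 * (ρ ^ 2 / 20 - 1) ≤ (M : ℝ) * (M - 1) :=
        mul_le_mul hM1 (by linarith) (by nlinarith) (by positivity)
      nlinarith [mul_pos hρ0 hρ0]
    -- Uses `10¹² K³ l = ρ⁴`. The gain `7Kl` exceeds the union bound cost `2ml` by at least `l`.
    have hquot : 7 * (K * l) ≤ 1 / (N : ℝ) ^ 2 * ((M : ℝ) * (M - 1) / 16) := by
      rw [one_div_mul_eq_div, le_div_iff₀ hNpos]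
      have h1 : 7 * (K * l) * (N : ℝ) ^ 2 ≤ 7 * (K * l) * (17000000 * K ^ 2) :=
        mul_le_mul_of_nonneg_left hNK (by positivity)
      have h2 : 0 ≤ K ^ 3 * l := by positivity
      nlinarith
    have hml : (m : ℝ) * (l + l) ≤ (K + 1) * (l + l) :=
      mul_le_mul_of_nonneg_right hm2.le (by linarith)
    have hKl : 100 * l ≤ K * l := mul_le_mul_of_nonneg_right hK100 hl0.le
    push_cast
    rw [mul_zero, zero_div, zero_add]
    linarith
  calc _ ≤ _ := measure_mono hcover
    _ ≤ _ := measure_union_le _ _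
    _ ≤ ENNReal.ofReal (Real.exp (-l)) + ENNReal.ofReal (Real.exp (-l)) :=
      add_le_add (hfew.trans (ENNReal.ofReal_le_ofReal hexp1))
        (hsep.trans (ENNReal.ofReal_le_ofReal hexp2))
    _ = _ := by
      rw [← ENNReal.ofReal_add (Real.exp_pos _).le (Real.exp_pos _).le, two_mul]

end LocalizationGame

end

theorem mainTheorem2 (r : ℕ → ℝ)
    (hr : ∀ᶠ n : ℕ in atTop, Real.log n ≤ r n ∧ r n < Real.sqrt n / 4) :
    Tendsto
      (fun n : ℕ => LocalizationGame.pointsLaw n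
        {x | LocalizationGame.RobberEvadesIn
          (LocalizationGame.torusGraph (Real.sqrt n) (r n) x)
          ((10 : ℝ) ^ (-4 : ℤ) * r n ^ ((4 : ℝ) / 3) / Real.log n ^ ((1 : ℝ) / 3))
          (LocalizationGame.centralBall (r n / 3) x)})
      atTop (𝓝 1) := by
  have hlog : Tendsto (fun n : ℕ => Real.log n) atTop atTop :=
    Real.tendsto_log_atTop.comp tendsto_natCast_atTop_atTop
  have hprob : ∀ᶠ n : ℕ in atTop, IsProbabilityMeasure (LocalizationGame.pointsLaw n) := by
    filter_upwards [eventually_gt_atTop 0] with n hn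
    have := LocalizationGame.isProbabilityMeasure_cond_square hn
    unfold LocalizationGame.pointsLaw
    infer_instance
  have hlim : Tendsto (fun n : ℕ => 1 - ENNReal.ofReal (2 * Real.exp (-Real.log n))) atTop (𝓝 1) := by
    have h0 : Tendsto (fun n : ℕ => 2 * Real.exp (-Real.log n)) atTop (𝓝 0) := by
      simpa using (Real.tendsto_exp_neg_atTop_nhds_zero.comp hlog).const_mul 2
    have h1 := ENNReal.tendsto_ofReal h0
    rw [ENNReal.ofReal_zero] at h1
    simpa using ENNReal.Tendsto.sub (tendsto_const_nhds (x := (1 : ENNReal))) h1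
      (Or.inl ENNReal.one_ne_top)
  refine tendsto_of_tendsto_of_tendsto_of_le_of_le' hlim tendsto_const_nhds ?_ ?_
  · filter_upwards [hr, hprob, hlog.eventually_ge_atTop ((10 : ℝ) ^ 6)] with n hn hp hl
    rw [tsub_le_iff_right, ← measure_univ (μ := LocalizationGame.pointsLaw n)]
    refine le_trans ?_ (add_le_add le_rfl (LocalizationGame.pointsLaw_not_evades_le hl hn.1 hn.2))
    -- Subadditivity over the event and its complement needs no measurability of the evasion event.
    refine le_trans (measure_mono ?_) (measure_union_le _ _)
    exact (Set.union_compl_self _).ge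
  · filter_upwards [hprob] with n hp
    exact prob_le_one
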